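/- Let $p\ge 1$ be an integer. For $\mu>0$ and a real-valued $\psi\in H^2(\mathbb R)$ put $$I_{\mu}(\psi)=\int_{\mathbb R}\Big[\frac{\mu}{2}(\psi'')^2+\frac12(\psi')^2+\frac12\psi^2\Big]\,dx,\qquad K_p(\psi)=\frac{1}{(p+1)(p+2)}\int_{\mathbb R}\psi^{p+2}\,dx,$$ let $H^2_e(\mathbb R)$ be the space of even functions in $H^2(\mathbb R)$, and let $$\varphi_{1,p,0}(x)=\Big[\frac{(p+1)(p+2)}{2}\Big]^{1/p}\operatorname{sech}^{2/p}\Big(\frac{p}{2}x\Big)$$ be the soliton of speed $1$ of the generalized KdV equation. Put $\beta_p=K_p(\varphi_{1,p,0})$. Then there is $\mu_0>0$, depending only on $p$, and for every $\mu\in(0,\mu_0)$ there are $\psi_{p,\mu}\in H^2_e(\mathbb R)$ and $\alpha_{p,\mu}>0$ such that: 1. $\psi_{p,\mu}$ is a minimizer of $I_\mu$ over $\{\psi\in H^2_e(\mathbb R): K_p(\psi)=\beta_p\}$; 2. $\alpha_{p,\mu}$ is its Lagrange multiplier: for all $\chi\in H^2(\mathbb R)$, $$\mu\int\psi_{p,\mu}''\chi''+\int\psi_{p,\mu}'\chi'+\int\psi_{p,\mu}\chi=\frac{\alpha_{p,\mu}}{p+1}\int\psi_{p,\mu}^{p+1}\chi;$$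 3. $\varphi_{1,p,\mu}:=\alpha_{p,\mu}^{1/p}\,\psi_{p,\mu}$ is an even function in $H^4(\mathbb R)$, of class $C^4$, and solves $$\mu\varphi''''-\varphi''+\varphi=\frac{1}{p+1}\varphi^{p+1}\quad\text{at every point of }\mathbb R;$$ 4. $\displaystyle\lim_{\mu\to0^+}\|\varphi_{1,p,\mu}-\varphi_{1,p,0}\|_{H^1(\mathbb R)}=0.$ -/

import Mathlib

open MeasureTheory Filter Topology Set
open scoped ContDiff

namespace GKW

/-- `v` is a weak (distributional) derivative of `u` on `ℝ`. -/
def HasWeakDeriv (u v : ℝ → ℝ) : Prop :=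
  LocallyIntegrable u volume ∧ LocallyIntegrable v volume ∧
    ∀ η : ℝ → ℝ, ContDiff ℝ ∞ η → HasCompactSupport η →
      ∫ x, u x * deriv η x = - ∫ x, v x * η x

/-- `u` belongs to the Sobolev space `H^k(ℝ)` (real-valued): `u` and its weak derivatives
up to order `k` are square integrable. -/
def MemH : ℕ → (ℝ → ℝ) → Prop
  | 0, u => MemLp u 2 volume
  | k + 1, u => MemLp u 2 volume ∧ ∃ v : ℝ → ℝ, HasWeakDeriv u v ∧ MemH k v

open Classical in
/-- The weak derivative of `u` (unique up to a null set), when it has one. -/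
noncomputable def weakDeriv (u : ℝ → ℝ) : ℝ → ℝ :=
  if h : ∃ v : ℝ → ℝ, HasWeakDeriv u v then h.choose else 0

/-- The `H^1(ℝ)` norm. -/
noncomputable def normH1 (u : ℝ → ℝ) : ℝ :=
  Real.sqrt (∫ x, ((u x) ^ 2 + (weakDeriv u x) ^ 2))

/-- `u` belongs to `H^2_e(ℝ)`, the even functions of `H^2(ℝ)`
(evenness of the class of `u` modulo null sets). -/
def MemH2e (u : ℝ → ℝ) : Prop :=
  MemH 2 u ∧ ∀ᵐ x ∂(volume : Measure ℝ), u (-x) = u x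

/-- The quadratic functional `I_{c,μ}`. -/
noncomputable def energyI (c μ : ℝ) (u : ℝ → ℝ) : ℝ :=
  ∫ x, (μ / 2 * (weakDeriv (weakDeriv u) x) ^ 2 + 1 / 2 * (weakDeriv u x) ^ 2
    + c / 2 * (u x) ^ 2)

/-- The constraint functional `K_p`. -/
noncomputable def constraintK (p : ℕ) (u : ℝ → ℝ) : ℝ :=
  1 / (((p : ℝ) + 1) * ((p : ℝ) + 2)) * ∫ x, (u x) ^ (p + 2)

/-- The gKdV soliton `φ_{c,p,0}`. -/
noncomputable def soliton (c : ℝ) (p : ℕ) (x : ℝ) : ℝ :=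
  ((((p : ℝ) + 1) * ((p : ℝ) + 2) * c) / 2) ^ (1 / (p : ℝ)) *
    (1 / Real.cosh ((p : ℝ) * Real.sqrt c / 2 * x)) ^ (2 / (p : ℝ))

/-- `ψ` minimizes `I_{c,μ}` among the `χ ∈ H^2_e(ℝ)` with `K_p(χ) = β`. -/
def IsEvenMinimizer (c : ℝ) (p : ℕ) (μ β : ℝ) (ψ : ℝ → ℝ) : Prop :=
  MemH2e ψ ∧ constraintK p ψ = β ∧
    ∀ χ : ℝ → ℝ, MemH2e χ → constraintK p χ = β → energyI c μ ψ ≤ energyI c μ χ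

/-- `α` is a Lagrange multiplier for `ψ`: the Euler-Lagrange equation
`I_{c,μ}'(ψ) = α K_p'(ψ)` holds, tested against every function of `H^2(ℝ)`. -/
def IsLagrangeMultiplier (c : ℝ) (p : ℕ) (μ : ℝ) (ψ : ℝ → ℝ) (α : ℝ) : Prop :=
  ∀ χ : ℝ → ℝ, MemH 2 χ →
    μ * (∫ x, weakDeriv (weakDeriv ψ) x * weakDeriv (weakDeriv χ) x)
      + (∫ x, weakDeriv ψ x * weakDeriv χ x) + c * (∫ x, ψ x * χ x)
      = α / ((p : ℝ) + 1) * ∫ x, (ψ x) ^ (p + 1) * χ x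

/-- `φ` solves `μ φ'''' - φ'' + c φ = φ^{p+1} / (p+1)` at every point of `ℝ`. -/
def IsSolitaryWave (c : ℝ) (p : ℕ) (μ : ℝ) (φ : ℝ → ℝ) : Prop :=
  ContDiff ℝ 4 φ ∧ ∀ x : ℝ,
    μ * iteratedDeriv 4 φ x - iteratedDeriv 2 φ x + c * φ x
      = 1 / ((p : ℝ) + 1) * (φ x) ^ (p + 1)

end GKW

open GKW

/-! Compactness comes from a sharp inequality rather than from translations. Put `β = constraintK p
(soliton 1 p)`, `a = 2 / (p + 2) < 1`, and let `G` be `potential p`, so that the soliton satisfies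
`φ'² = G(φ)`. On a half line the action density is `(u'² + G(|u|)) / 2 ≥ √G(|u|) |u'|`. A function
whose modulus peaks at the height of the soliton must climb to it and come back to `0`, which costs
the action of the soliton up to an endpoint term `u(c)² / 2` (`action_half_line_ge`). Rescaling and
Young's inequality turn this into a homogeneous bound of the energy by the power `a` of the
constraint (`sharp_half_line`). Letting the endpoint go to `-∞` gives the sharp inequality on the
line, with constant `(p + 2) / 2 * β`.

For even functions the half-line bound is used on both sides of the origin. Each side carries half
of `∫ |u|^(p+2)`, so the constant gains a factor `2 * (1/2)^a > 1`, up to `u(0)²` (`sharp_even`).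
For an even minimizing sequence with limit `U`, the remainder is even and tends to `0` at the
origin, so it pays this larger constant `B`. The energy splits as `m = J + R` with `J ≥ θ^a m` when
`θ = K(U) / β > 0`, and `R ≥ B |1 - θ|^a`. If `m < B` this forces `θ = 1` (`theta_eq_one`,
`constraintK_limit_eq`), so nothing is lost and the limit is a minimizer. Testing with the soliton
shows `m < B` for small `μ`, and this is the only restriction on `μ₀`.

By homogeneity, minimality is an inequality free of constraint on `{K > 0}`, whose derivative is the
Euler-Lagrange equation with multiplier `2m / ((p + 2) β)`. Evenness of the minimizer extends it
from even to all test functions. Read distributionally, the equation yields `H^4` and `C^4`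
regularity, and scaling by `α^(1/p)` normalizes it.

As `μ → 0` the minimal energy is squeezed to `(p + 2) / 2 * β`, whence `α → 1`, and the minimizers
form minimizing sequences of the limit problem in `H^1`. The same compactness argument gives strong
convergence along subsequences. The limit solves the soliton equation, and its first integral
together with uniqueness for the initial value problem identifies it, the sign being normalized for
even `p`. -/

namespace GKW

/-! ### Calculus of primitives of locally integrable functions -/

/-- `u` is a primitive of the locally integrable function `v`. -/
def IsPrim (u v : ℝ → ℝ) : Prop :=
  LocallyIntegrable v volume ∧ ∀ a b : ℝ, u b - u a = ∫ t in a..b, v t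

namespace IsPrim

variable {u v f g : ℝ → ℝ}

theorem intervalIntegrable (h : IsPrim u v) (a b : ℝ) : IntervalIntegrable v volume a b :=
  (h.1.integrableOn_isCompact isCompact_uIcc).intervalIntegrable

theorem eq_add (h : IsPrim u v) (a x : ℝ) : u x = u a + ∫ t in a..x, v t := by
  rw [← h.2 a x]; ring

theorem continuous (h : IsPrim u v) : Continuous u := by
  have : u = fun x => u 0 + ∫ t in (0 : ℝ)..x, v t := funext fun x => h.eq_add 0 x
  rw [this]
  exact continuous_const.add
    (intervalIntegral.continuous_primitive (fun a b => h.intervalIntegrable a b) 0)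

theorem absolutelyContinuous (h : IsPrim u v) (a b : ℝ) :
    AbsolutelyContinuousOnInterval u a b := by
  have h1 : u = (fun _ => u a) + fun x => ∫ t in a..x, v t := funext fun x => h.eq_add a x
  rw [h1]
  refine AbsolutelyContinuousOnInterval.add ?_ ?_
  · exact (contDiff_const.contDiffOn).absolutelyContinuousOnInterval
  · exact (h.intervalIntegrable a b).absolutelyContinuousOnInterval_intervalIntegral left_mem_uIcc

theorem ae_hasDerivAt (h : IsPrim u v) : ∀ᵐ x, HasDerivAt u (v x) x := by
  filter_upwards [LocallyIntegrable.ae_hasDerivAt_integral h.1] with x hx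
  have h1 : u = fun x => u 0 + ∫ t in (0 : ℝ)..x, v t := funext fun x => h.eq_add 0 x
  rw [h1]
  exact (hx 0).const_add _

theorem congr_right (h : IsPrim u v) (hv : v =ᵐ[volume] g) : IsPrim u g :=
  ⟨(locallyIntegrable_congr hv).1 h.1, fun a b => by
    rw [h.2 a b]
    exact intervalIntegral.integral_congr_ae (hv.mono fun x hx _ => hx)⟩

/-- Primitives are absolutely continuous, so integration by parts holds although the derivatives
exist only almost everywhere. -/
theorem mul (h : IsPrim u v) (k : IsPrim f g) :
    IsPrim (fun x => u x * f x) (fun x => v x * f x + u x * g x) := by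
  refine ⟨?_, fun a b => ?_⟩
  · refine LocallyIntegrable.add ?_ ?_
    · rw [locallyIntegrable_iff]
      intro K hK
      exact (h.1.integrableOn_isCompact hK).mul_continuousOn k.continuous.continuousOn hK
    · rw [locallyIntegrable_iff]
      intro K hK
      exact (k.1.integrableOn_isCompact hK).continuousOn_mul h.continuous.continuousOn hK
  · rw [← (h.absolutelyContinuous a b).integral_deriv_mul_eq_sub (k.absolutelyContinuous a b)]
    apply intervalIntegral.integral_congr_ae
    filter_upwards [h.ae_hasDerivAt, k.ae_hasDerivAt] with x hx hx' _
    rw [hx.deriv, hx'.deriv]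

theorem add (h : IsPrim u v) (k : IsPrim f g) :
    IsPrim (fun x => u x + f x) (fun x => v x + g x) := by
  refine ⟨h.1.add k.1, fun a b => ?_⟩
  rw [intervalIntegral.integral_add (h.intervalIntegrable a b) (k.intervalIntegrable a b),
    ← h.2, ← k.2]
  ring

theorem const_mul (c : ℝ) (h : IsPrim u v) : IsPrim (fun x => c * u x) (fun x => c * v x) := by
  refine ⟨h.1.smul c, fun a b => ?_⟩
  rw [intervalIntegral.integral_const_mul, ← h.2]
  ring

theorem sub (h : IsPrim u v) (k : IsPrim f g) :
    IsPrim (fun x => u x - f x) (fun x => v x - g x) := by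
  have := h.add (k.const_mul (-1))
  simpa [sub_eq_add_neg] using this

theorem comp_neg (h : IsPrim u v) : IsPrim (fun x => u (-x)) (fun x => -v (-x)) := by
  refine ⟨?_, fun a b => ?_⟩
  · have h1 : LocallyIntegrable (fun x => v (-x)) volume := by
      have := (locallyIntegrable_map_homeomorph (μ := volume) (f := v) (Homeomorph.neg ℝ)).1
      refine this ?_
      have h2 : Measure.map (⇑(Homeomorph.neg ℝ)) (volume : Measure ℝ) = volume := by
        exact Measure.map_neg_eq_self (volume : Measure ℝ)
      rw [h2]; exact h.1
    exact h1.neg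
  · rw [intervalIntegral.integral_neg, intervalIntegral.integral_comp_neg (fun x => v x), ← h.2]
    ring

theorem of_hasDerivAt (h : ∀ x, HasDerivAt u (v x) x) (hv : Continuous v) : IsPrim u v :=
  ⟨hv.locallyIntegrable, fun a b =>
    (intervalIntegral.integral_eq_sub_of_hasDerivAt (fun x _ => h x)
      (hv.intervalIntegrable a b)).symm⟩

theorem hasDerivAt (h : IsPrim u v) (hv : Continuous v) (x : ℝ) : HasDerivAt u (v x) x := by
  have h1 : u = fun x => u 0 + ∫ t in (0 : ℝ)..x, v t := funext fun x => h.eq_add 0 x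
  rw [h1]
  exact (intervalIntegral.integral_hasDerivAt_right (hv.intervalIntegrable _ _)
    (hv.stronglyMeasurableAtFilter _ _) hv.continuousAt).const_add _

theorem integral_eq_zero_of_isCompact (h : IsPrim u v) {K : Set ℝ} (hK : IsCompact K)
    (hu : ∀ x, x ∉ K → u x = 0) (hv : ∀ x, x ∉ K → v x = 0) : ∫ x, v x = 0 := by
  obtain ⟨R, hR⟩ := hK.isBounded.subset_closedBall 0
  rw [Real.closedBall_eq_Icc] at hR
  have hsub : K ⊆ Ioo (-|R| - 1) (|R| + 1) := by
    intro x hx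
    have := hR hx
    have h2 := le_abs_self R
    exact ⟨by linarith [this.1], by linarith [this.2]⟩
  have hz : ∀ x, x ∉ Ioo (-|R| - 1) (|R| + 1) → u x = 0 := fun x hx =>
    hu x fun h' => hx (hsub h')
  have h0 : ∫ x in (-|R| - 1)..(|R| + 1), v x = 0 := by
    rw [← h.2, hz _ (by simp), hz _ (by simp), sub_zero]
  have hle : (-|R| - 1) ≤ |R| + 1 := by linarith [abs_nonneg R]
  rw [intervalIntegral.integral_of_le hle] at h0
  rw [← h0, setIntegral_eq_integral_of_forall_compl_eq_zero]
  intro x hx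
  exact hv x fun h' => hx (Ioo_subset_Ioc_self (hsub h'))

theorem hasWeakDeriv (h : IsPrim u v) : HasWeakDeriv u v := by
  refine ⟨h.continuous.locallyIntegrable, h.1, fun η hη hc => ?_⟩
  have hd : ∀ x, HasDerivAt η (deriv η x) x := fun x =>
    ((hη.differentiable (by simp)) x).hasDerivAt
  have hη' : Continuous (deriv η) := hη.continuous_deriv (by exact_mod_cast le_top)
  have hη1 : IsPrim η (deriv η) := of_hasDerivAt hd hη'
  have hz : ∀ x, x ∉ tsupport η → η x = 0 := fun x hx => image_eq_zero_of_notMem_tsupport hx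
  have hz' : ∀ x, x ∉ tsupport η → deriv η x = 0 := fun x hx =>
    image_eq_zero_of_notMem_tsupport fun h' => hx (tsupport_deriv_subset h')
  have h1 := (h.mul hη1).integral_eq_zero_of_isCompact hc.isCompact
    (fun x hx => by simp [hz x hx]) (fun x hx => by simp [hz x hx, hz' x hx])
  rw [integral_add] at h1
  · linarith
  · exact h.1.integrable_smul_right_of_hasCompactSupport hη.continuous hc
  · exact (h.continuous.mul hη').integrable_of_hasCompactSupport hc.deriv.mul_left

end IsPrim

theorem _root_.LipschitzOnWith.comp_absolutelyContinuousOnInterval {F : ℝ → ℝ} {s : Set ℝ}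
    {K : NNReal} {u : ℝ → ℝ} {a b : ℝ} (hF : LipschitzOnWith K F s)
    (hu : AbsolutelyContinuousOnInterval u a b) (hs : MapsTo u (uIcc a b) s) :
    AbsolutelyContinuousOnInterval (fun x => F (u x)) a b := by
  rw [absolutelyContinuousOnInterval_iff] at hu ⊢
  intro ε hε
  -- Dividing by `K + 1` covers `K = 0` and leaves room for a strict inequality.
  obtain ⟨δ, hδ, h⟩ := hu (ε / (K + 1)) (by positivity)
  refine ⟨δ, hδ, fun E hE hE' => ?_⟩
  have h1 := h E hE hE'
  calc ∑ i ∈ Finset.range E.1, dist (F (u (E.2 i).1)) (F (u (E.2 i).2))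
      ≤ ∑ i ∈ Finset.range E.1, K * dist (u (E.2 i).1) (u (E.2 i).2) := by
        refine Finset.sum_le_sum fun i hi => ?_
        exact hF.dist_le_mul _ (hs (hE.1 i hi).1) _ (hs (hE.1 i hi).2)
    _ = K * ∑ i ∈ Finset.range E.1, dist (u (E.2 i).1) (u (E.2 i).2) := by rw [Finset.mul_sum]
    _ ≤ K * (ε / (K + 1)) := by gcongr
    _ < (K + 1) * (ε / (K + 1)) := by gcongr; linarith
    _ = ε := by field_simp

/-- On a compact interval `u` stays in a compact set, where the `C^1` function `F` is Lipschitz;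
hence `F ∘ u` is again absolutely continuous. It is needed with `F = primSqrtPotential p`. -/
theorem IsPrim.comp {u v F F' : ℝ → ℝ} (h : IsPrim u v) (hF : ∀ x, HasDerivAt F (F' x) x)
    (hF' : Continuous F') : IsPrim (fun x => F (u x)) (fun x => F' (u x) * v x) := by
  refine ⟨?_, fun a b => ?_⟩
  · rw [locallyIntegrable_iff]
    intro K hK
    exact (h.1.integrableOn_isCompact hK).continuousOn_mul
      (hF'.comp h.continuous).continuousOn hK
  · have hC : ContDiff ℝ 1 F := by
      refine contDiff_one_iff_deriv.2 ⟨fun x => (hF x).differentiableAt, ?_⟩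
      have : deriv F = F' := funext fun x => (hF x).deriv
      rwa [this]
    obtain ⟨m, M, hm⟩ : ∃ m M, u '' uIcc a b ⊆ Icc m M := by
      obtain ⟨R, hR⟩ := (isCompact_uIcc.image h.continuous).isBounded.subset_closedBall 0
      rw [Real.closedBall_eq_Icc] at hR
      exact ⟨_, _, hR⟩
    obtain ⟨K, hK⟩ := (hC.contDiffOn (s := Icc m M)).exists_lipschitzOnWith (by decide)
      (convex_Icc m M) isCompact_Icc
    have hac := hK.comp_absolutelyContinuousOnInterval (h.absolutelyContinuous a b)
      (mapsTo_iff_image_subset.2 hm)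
    rw [← hac.integral_deriv_eq_sub]
    apply intervalIntegral.integral_congr_ae
    filter_upwards [h.ae_hasDerivAt] with x hx _
    exact ((hF (u x)).comp x hx).deriv

/-! ### Weak derivatives and absolutely continuous representatives -/

theorem HasWeakDeriv.congr_left {u f v : ℝ → ℝ} (h : HasWeakDeriv u v) (hu : u =ᵐ[volume] f) :
    HasWeakDeriv f v := by
  refine ⟨(locallyIntegrable_congr hu).1 h.1, h.2.1, fun η hη hc => ?_⟩
  rw [← h.2.2 η hη hc]
  exact integral_congr_ae (hu.mono fun x hx => by simp [hx])

theorem HasWeakDeriv.ae_eq {u v w : ℝ → ℝ} (h : HasWeakDeriv u v) (h' : HasWeakDeriv u w) :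
    v =ᵐ[volume] w := by
  refine ae_eq_of_integral_contDiff_smul_eq h.2.1 h'.2.1 fun g hg hc => ?_
  have := (h.2.2 g hg hc).symm.trans (h'.2.2 g hg hc)
  simp only [smul_eq_mul, mul_comm (g _)]
  linarith

theorem HasWeakDeriv.weakDeriv_ae_eq {u v : ℝ → ℝ} (h : HasWeakDeriv u v) :
    weakDeriv u =ᵐ[volume] v := by
  have h1 : ∃ v, HasWeakDeriv u v := ⟨v, h⟩
  have h2 : weakDeriv u = h1.choose := by unfold weakDeriv; rw [dif_pos h1]
  rw [h2]
  exact h1.choose_spec.ae_eq h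

/-- A smooth compactly supported function of integral zero is the derivative of one. -/
theorem exists_primitive_hasCompactSupport {χ : ℝ → ℝ} (hχ : ContDiff ℝ ∞ χ)
    (hc : HasCompactSupport χ) (h0 : ∫ x, χ x = 0) :
    ∃ η : ℝ → ℝ, ContDiff ℝ ∞ η ∧ HasCompactSupport η ∧ deriv η = χ := by
  obtain ⟨R, hR⟩ := hc.isCompact.isBounded.subset_closedBall 0
  rw [Real.closedBall_eq_Icc] at hR
  have hz : ∀ x, x ∉ Icc (0 - R) (0 + R) → χ x = 0 := fun x hx =>
    image_eq_zero_of_notMem_tsupport fun h' => hx (hR h')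
  have hd : ∀ x, HasDerivAt (fun x => ∫ t in (-|R| - 1)..x, χ t) (χ x) x := fun x =>
    intervalIntegral.integral_hasDerivAt_right (hχ.continuous.intervalIntegrable _ _)
      (hχ.continuous.stronglyMeasurableAtFilter _ _) hχ.continuous.continuousAt
  have hder : deriv (fun x => ∫ t in (-|R| - 1)..x, χ t) = χ := funext fun x => (hd x).deriv
  refine ⟨fun x => ∫ t in (-|R| - 1)..x, χ t, ?_, ?_, hder⟩
  · rw [contDiff_infty_iff_deriv]
    exact ⟨fun x => (hd x).differentiableAt, by rwa [hder]⟩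
  · refine HasCompactSupport.intro (isCompact_Icc (a := -|R| - 1) (b := |R| + 1)) fun x hx => ?_
    have hRa := le_abs_self R
    by_cases h1 : x < -|R| - 1
    · refine intervalIntegral.integral_zero_ae (ae_of_all _ fun t ht => hz t ?_)
      rw [uIoc_of_ge h1.le] at ht
      intro h'
      linarith [h'.1, ht.2]
    · have h2 : |R| + 1 < x := by
        by_contra h3
        exact hx ⟨not_lt.1 h1, not_lt.1 h3⟩
      rw [← h0, intervalIntegral.integral_of_le (not_lt.1 h1),
        setIntegral_eq_integral_of_forall_compl_eq_zero]
      intro t ht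
      refine hz t fun h' => ht ⟨by linarith [h'.1], by linarith [h'.2]⟩

/-- The du Bois-Reymond lemma. With a bump `ρ` of integral one, `g - (∫ g) ρ` has integral zero for
every test function `g`, hence is the derivative of a test function; testing with that function
shows that `u` acts as the constant `∫ u ρ`. -/
theorem ae_const_of_integral_deriv_eq_zero {u : ℝ → ℝ} (hu : LocallyIntegrable u volume)
    (h : ∀ η : ℝ → ℝ, ContDiff ℝ ∞ η → HasCompactSupport η → ∫ x, u x * deriv η x = 0) :
    ∃ c : ℝ, ∀ᵐ x, u x = c := by
  let b : ContDiffBump (0 : ℝ) := ⟨1, 2, by norm_num, by norm_num⟩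
  let ρ : ℝ → ℝ := b.normed volume
  have hρ : ContDiff ℝ ∞ ρ := b.contDiff_normed
  have hρc : HasCompactSupport ρ := b.hasCompactSupport_normed
  have hρ1 : ∫ x, ρ x = 1 := b.integral_normed
  refine ⟨∫ x, u x * ρ x, ae_eq_of_integral_contDiff_smul_eq hu (locallyIntegrable_const _)
    fun g hg hc => ?_⟩
  have hgi : Integrable g := hg.continuous.integrable_of_hasCompactSupport hc
  have hρi : Integrable ρ := hρ.continuous.integrable_of_hasCompactSupport hρc
  have hug : Integrable (fun x => u x * g x) :=
    hu.integrable_smul_right_of_hasCompactSupport hg.continuous hc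
  have huρ : Integrable (fun x => u x * ρ x) :=
    hu.integrable_smul_right_of_hasCompactSupport hρ.continuous hρc
  obtain ⟨η, h1, h2, h3⟩ := exists_primitive_hasCompactSupport
    (χ := fun x => g x - (∫ y, g y) * ρ x) (hg.sub (contDiff_const.mul hρ))
    (hc.sub hρc.mul_left) (by
      rw [integral_sub hgi (hρi.const_mul _), integral_const_mul, hρ1]; ring)
  have h4 := h η h1 h2
  rw [h3] at h4
  have h5 : ∀ x, u x * (g x - (∫ y, g y) * ρ x) = u x * g x - (∫ y, g y) * (u x * ρ x) :=
    fun x => by ring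
  simp_rw [h5] at h4
  rw [integral_sub hug (huρ.const_mul _), integral_const_mul] at h4
  simp only [smul_eq_mul, mul_comm (g _)]
  rw [integral_const_mul]
  linarith

/-- The difference of `u` and a primitive of `v` has zero weak derivative, so it is almost
everywhere constant. -/
theorem HasWeakDeriv.exists_isPrim {u v : ℝ → ℝ} (h : HasWeakDeriv u v) :
    ∃ f : ℝ → ℝ, u =ᵐ[volume] f ∧ IsPrim f v := by
  have hi : ∀ a b, IntervalIntegrable v volume a b := fun a b =>
    (h.2.1.integrableOn_isCompact isCompact_uIcc).intervalIntegrable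
  have hw : IsPrim (fun x => ∫ t in (0 : ℝ)..x, v t) v :=
    ⟨h.2.1, fun a b => intervalIntegral.integral_interval_sub_left (hi _ _) (hi _ _)⟩
  obtain ⟨c, hc⟩ := ae_const_of_integral_deriv_eq_zero
    (u := fun x => u x - ∫ t in (0 : ℝ)..x, v t) (h.1.sub hw.continuous.locallyIntegrable) (by
      intro η hη hηc
      have hη' : Continuous (deriv η) := hη.continuous_deriv (by exact_mod_cast le_top)
      simp_rw [sub_mul]
      rw [integral_sub, h.2.2 η hη hηc, hw.hasWeakDeriv.2.2 η hη hηc, sub_self]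
      · exact h.1.integrable_smul_right_of_hasCompactSupport hη' hηc.deriv
      · exact (hw.continuous.mul hη').integrable_of_hasCompactSupport hηc.deriv.mul_left)
  refine ⟨fun x => c + ∫ t in (0 : ℝ)..x, v t, hc.mono fun x hx => ?_, h.2.1, fun a b => ?_⟩
  · show u x = c + _
    rw [← hx]; ring
  · rw [← hw.2]; ring

/-! ### Continuous representatives in `H^1(ℝ)`: decay, sup bound, integration by parts -/

/-- `u` is a continuous function in `H^1(ℝ)` with derivative `v`. -/
structure H1Pair (u v : ℝ → ℝ) : Prop where
  memLp : MemLp u 2 volume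
  memLp' : MemLp v 2 volume
  prim : IsPrim u v

/-- Integrability of `g` makes the limit exist, and integrability of `f` leaves only the value zero.
-/
theorem IsPrim.tendsto_atTop_zero {f g : ℝ → ℝ} (h : IsPrim f g) (hf : Integrable f)
    (hg : Integrable g) : Tendsto f atTop (𝓝 0) := by
  have h1 : Tendsto f atTop (𝓝 (f 0 + ∫ x in Ioi (0 : ℝ), g x)) := by
    have h2 := (intervalIntegral_tendsto_integral_Ioi 0 hg.integrableOn tendsto_id).const_add (f 0)
    refine h2.congr fun x => ?_
    exact (h.eq_add 0 x).symm
  have h3 : f 0 + ∫ x in Ioi (0 : ℝ), g x = 0 := by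
    refine IntegrableAtFilter.eq_zero_of_tendsto (μ := volume) (l := atTop) ?_ ?_ h1
    · exact ⟨univ, univ_mem, hf.integrableOn⟩
    · intro s hs
      obtain ⟨b, hb⟩ := mem_atTop_sets.1 hs
      exact top_unique ((Real.volume_Ici (a := b)).symm.le.trans (measure_mono hb))
  rwa [h3] at h1

theorem IsPrim.integral_Ioi {f g : ℝ → ℝ} (h : IsPrim f g) (hf : Integrable f)
    (hg : Integrable g) (c : ℝ) : ∫ x in Ioi c, g x = - f c := by
  have h2 := (intervalIntegral_tendsto_integral_Ioi c hg.integrableOn tendsto_id)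
  have h3 := (h.tendsto_atTop_zero hf hg).sub_const (f c)
  have h4 := tendsto_nhds_unique h2 (h3.congr fun x => h.2 c x)
  rw [h4, zero_sub]

theorem IsPrim.integral_eq_zero {f g : ℝ → ℝ} (h : IsPrim f g) (hf : Integrable f)
    (hg : Integrable g) : ∫ x, g x = 0 := by
  have h1 := h.integral_Ioi hf hg 0
  have h2 := h.comp_neg.integral_Ioi hf.comp_neg hg.comp_neg.neg 0
  rw [integral_neg, integral_comp_neg_Ioi] at h2
  rw [← intervalIntegral.integral_Iic_add_Ioi (b := (0 : ℝ)) hg.integrableOn hg.integrableOn]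
  simp only [neg_zero] at h2
  linarith

namespace H1Pair

variable {u v f g : ℝ → ℝ}

theorem continuous (h : H1Pair u v) : Continuous u := h.prim.continuous

theorem integrable_sq (h : H1Pair u v) : Integrable (fun x => u x ^ 2) := h.memLp.integrable_sq

theorem integrable_sq' (h : H1Pair u v) : Integrable (fun x => v x ^ 2) := h.memLp'.integrable_sq

theorem add (h : H1Pair u v) (k : H1Pair f g) :
    H1Pair (fun x => u x + f x) (fun x => v x + g x) :=
  ⟨h.memLp.add k.memLp, h.memLp'.add k.memLp', h.prim.add k.prim⟩

theorem const_mul (c : ℝ) (h : H1Pair u v) : H1Pair (fun x => c * u x) (fun x => c * v x) :=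
  ⟨h.memLp.const_mul c, h.memLp'.const_mul c, h.prim.const_mul c⟩

theorem sub (h : H1Pair u v) (k : H1Pair f g) :
    H1Pair (fun x => u x - f x) (fun x => v x - g x) :=
  ⟨h.memLp.sub k.memLp, h.memLp'.sub k.memLp', h.prim.sub k.prim⟩

theorem neg (h : H1Pair u v) : H1Pair (fun x => - u x) (fun x => - v x) := by
  simpa using h.const_mul (-1)

theorem _root_.MeasureTheory.MemLp.comp_neg_real {f : ℝ → ℝ} (h : MemLp f 2 volume) :
    MemLp (fun x => f (-x)) 2 volume :=
  h.comp_measurePreserving (Measure.measurePreserving_neg volume)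

theorem comp_neg (h : H1Pair u v) : H1Pair (fun x => u (-x)) (fun x => - v (-x)) :=
  ⟨h.memLp.comp_neg_real, h.memLp'.comp_neg_real.neg, h.prim.comp_neg⟩

theorem congr_right (h : H1Pair u v) (hv : v =ᵐ[volume] g) : H1Pair u g :=
  ⟨h.memLp, h.memLp'.ae_eq hv, h.prim.congr_right hv⟩

theorem integrable_sq_add_sq (h : H1Pair u v) : Integrable (fun x => u x ^ 2 + v x ^ 2) :=
  h.integrable_sq.add h.integrable_sq'

theorem isPrim_sq (h : H1Pair u v) : IsPrim (fun x => u x ^ 2) (fun x => 2 * (u x * v x)) := by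
  have := h.prim.mul h.prim
  convert this using 2 <;> ring

theorem integrable_mul (h : MemLp u 2 volume) (k : MemLp f 2 volume) :
    Integrable (fun x => u x * f x) :=
  MemLp.integrable_mul h k

theorem tendsto_atTop (h : H1Pair u v) : Tendsto u atTop (𝓝 0) := by
  have := h.isPrim_sq.tendsto_atTop_zero h.integrable_sq
    ((integrable_mul h.memLp h.memLp').const_mul 2)
  have h2 := (Real.continuous_sqrt.tendsto 0).comp this
  rw [Real.sqrt_zero] at h2
  rw [tendsto_zero_iff_abs_tendsto_zero]
  exact h2.congr fun x => Real.sqrt_sq_eq_abs (u x)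

theorem tendsto_atBot (h : H1Pair u v) : Tendsto u atBot (𝓝 0) := by
  have h2 := h.comp_neg.tendsto_atTop.comp tendsto_neg_atBot_atTop
  simpa [Function.comp_def] using h2

/-- The square `u²` vanishes at infinity, so `u(x)² = -∫_x^∞ 2uv`, and `-2uv ≤ u² + v²`. -/
theorem sq_le (h : H1Pair u v) (x : ℝ) : u x ^ 2 ≤ ∫ y, (u y ^ 2 + v y ^ 2) := by
  have hi : Integrable (fun x => 2 * (u x * v x)) :=
    (integrable_mul h.memLp h.memLp').const_mul 2
  have h1 := h.isPrim_sq.integral_Ioi h.integrable_sq hi x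
  calc u x ^ 2 = ∫ y in Ioi x, -(2 * (u y * v y)) := by rw [integral_neg, h1, neg_neg]
    _ ≤ ∫ y in Ioi x, (u y ^ 2 + v y ^ 2) := by
        refine setIntegral_mono hi.neg.integrableOn h.integrable_sq_add_sq.integrableOn fun y => ?_
        show -(2 * (u y * v y)) ≤ _
        nlinarith [sq_nonneg (u y + v y)]
    _ ≤ ∫ y, (u y ^ 2 + v y ^ 2) :=
        setIntegral_le_integral h.integrable_sq_add_sq (ae_of_all _ fun y => by positivity)

theorem abs_le (h : H1Pair u v) (x : ℝ) : |u x| ≤ √(∫ y, (u y ^ 2 + v y ^ 2)) :=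
  Real.abs_le_sqrt (h.sq_le x)

end H1Pair

theorem abs_pow_mul_pow_le {a b M : ℝ} (ha : |a| ≤ M) (hb : |b| ≤ M) {j k : ℕ}
    (hjk : 2 ≤ j + k) : |a ^ j * b ^ k| ≤ M ^ (j + k - 2) * (a ^ 2 + b ^ 2) := by
  set m := max |a| |b| with hm
  have hm0 : 0 ≤ m := (abs_nonneg a).trans (le_max_left _ _)
  have hmM : m ≤ M := max_le ha hb
  have hm2 : m ^ 2 ≤ a ^ 2 + b ^ 2 := by
    rcases max_choice |a| |b| with h | h <;> rw [hm, h, sq_abs]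
    · linarith [sq_nonneg b]
    · linarith [sq_nonneg a]
  calc |a ^ j * b ^ k| = |a| ^ j * |b| ^ k := by rw [abs_mul, abs_pow, abs_pow]
    _ ≤ m ^ j * m ^ k := by
        gcongr
        · exact le_max_left _ _
        · exact le_max_right _ _
    _ = m ^ (j + k - 2) * m ^ 2 := by rw [← pow_add, ← pow_add]; congr 1; omega
    _ ≤ M ^ (j + k - 2) * (a ^ 2 + b ^ 2) := by
        have := hm0.trans hmM
        gcongr

theorem H1Pair.integrable_pow_mul_pow {u v f g : ℝ → ℝ} (h : H1Pair u v) (k : H1Pair f g)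
    {i j : ℕ} (hij : 2 ≤ i + j) : Integrable (fun x => u x ^ i * f x ^ j) := by
  set M := max (√(∫ y, (u y ^ 2 + v y ^ 2))) (√(∫ y, (f y ^ 2 + g y ^ 2)))
  refine ((h.integrable_sq.add k.integrable_sq).const_mul (M ^ (i + j - 2))).mono'
    ((h.continuous.pow i).mul (k.continuous.pow j)).aestronglyMeasurable (ae_of_all _ fun x => ?_)
  exact abs_pow_mul_pow_le ((h.abs_le x).trans (le_max_left _ _))
    ((k.abs_le x).trans (le_max_right _ _)) hij

theorem H1Pair.integrable_pow {u v : ℝ → ℝ} (h : H1Pair u v) {i : ℕ} (hi : 2 ≤ i) :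
    Integrable (fun x => u x ^ i) := by
  simpa using h.integrable_pow_mul_pow h (i := i) (j := 0) hi

theorem H1Pair.integral_mul_add_mul {u v f g : ℝ → ℝ} (h : H1Pair u v) (k : H1Pair f g) :
    (∫ x, v x * f x) + ∫ x, u x * g x = 0 := by
  have hi1 := H1Pair.integrable_mul h.memLp' k.memLp
  have hi2 := H1Pair.integrable_mul h.memLp k.memLp'
  have h1 := (h.prim.mul k.prim).integral_eq_zero (H1Pair.integrable_mul h.memLp k.memLp)
    (hi1.add hi2)
  rwa [integral_add hi1 hi2] at h1

theorem H1Pair.weakDeriv_ae_eq {u v : ℝ → ℝ} (h : H1Pair u v) : weakDeriv u =ᵐ[volume] v :=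
  h.prim.hasWeakDeriv.weakDeriv_ae_eq

theorem H1Pair.weakDeriv_weakDeriv_ae_eq {u v w : ℝ → ℝ} (h : H1Pair u v) (k : H1Pair v w) :
    weakDeriv (weakDeriv u) =ᵐ[volume] w :=
  (k.prim.hasWeakDeriv.congr_left h.weakDeriv_ae_eq.symm).weakDeriv_ae_eq

theorem H1Pair.memH_two {u v w : ℝ → ℝ} (h : H1Pair u v) (k : H1Pair v w) : MemH 2 u :=
  ⟨h.memLp, v, h.prim.hasWeakDeriv, k.memLp, w, k.prim.hasWeakDeriv, k.memLp'⟩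

/-- The bridge from classes modulo null sets and the chosen `weakDeriv` to genuine continuous
functions, on which all estimates are made. -/
theorem MemH.exists_h1Pair {χ : ℝ → ℝ} (h : MemH 2 χ) :
    ∃ u v w : ℝ → ℝ, H1Pair u v ∧ H1Pair v w ∧ χ =ᵐ[volume] u ∧ weakDeriv χ =ᵐ[volume] v ∧
      weakDeriv (weakDeriv χ) =ᵐ[volume] w := by
  obtain ⟨h0, v, hv, h1, w, hw, h2⟩ := h
  obtain ⟨f, hf, hfw⟩ := hw.exists_isPrim
  obtain ⟨u, hu, huv⟩ := hv.exists_isPrim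
  have h2' : MemLp w 2 volume := h2
  have hd1 : weakDeriv χ =ᵐ[volume] f := hv.weakDeriv_ae_eq.trans hf
  exact ⟨u, f, w, ⟨h0.ae_eq hu, h1.ae_eq hf, huv.congr_right hf⟩, ⟨h1.ae_eq hf, h2', hfw⟩, hu, hd1,
    (hw.congr_left (hf.trans hd1.symm)).weakDeriv_ae_eq⟩

theorem even_of_ae_even {u f : ℝ → ℝ} (hu : ∀ᵐ x ∂(volume : Measure ℝ), u (-x) = u x)
    (h : u =ᵐ[volume] f) (hf : Continuous f) (x : ℝ) : f (-x) = f x := by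
  have h1 : (fun x => u (-x)) =ᵐ[volume] fun x => f (-x) :=
    (Measure.measurePreserving_neg (volume : Measure ℝ)).quasiMeasurePreserving.ae_eq h
  have h2 : (fun x => f (-x)) =ᵐ[volume] f := by
    filter_upwards [h1, hu, h] with x a b c
    rw [← a, b, c]
  exact congrFun ((Continuous.ae_eq_iff_eq volume (hf.comp continuous_neg) hf).1 h2) x

/-! ### Explicit identities for the soliton -/

/-- The derivative of the soliton of speed one. -/
noncomputable def soliton' (p : ℕ) (x : ℝ) : ℝ := -(Real.tanh ((p : ℝ) / 2 * x) * soliton 1 p x)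

/-- The second derivative of the soliton of speed one. -/
noncomputable def soliton'' (p : ℕ) (x : ℝ) : ℝ :=
  soliton 1 p x - soliton 1 p x ^ (p + 1) / ((p : ℝ) + 1)

/-- The maximum of the soliton of speed one. -/
noncomputable def solitonMax (p : ℕ) : ℝ := (((p : ℝ) + 1) * ((p : ℝ) + 2) / 2) ^ (1 / (p : ℝ))

theorem solitonMax_pos (p : ℕ) : 0 < solitonMax p := by
  unfold solitonMax; positivity

theorem solitonMax_pow {p : ℕ} (hp : 1 ≤ p) :
    solitonMax p ^ p = ((p : ℝ) + 1) * ((p : ℝ) + 2) / 2 := by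
  unfold solitonMax
  rw [one_div, Real.rpow_inv_natCast_pow (by positivity) (by omega)]

theorem soliton_one_eq (p : ℕ) (x : ℝ) :
    soliton 1 p x = solitonMax p * (Real.cosh ((p : ℝ) / 2 * x)) ^ (-(2 / (p : ℝ))) := by
  unfold soliton solitonMax
  rw [Real.sqrt_one, mul_one, mul_one, one_div (Real.cosh _),
    Real.inv_rpow (Real.cosh_pos _).le, Real.rpow_neg (Real.cosh_pos _).le]

theorem soliton_pos (p : ℕ) (x : ℝ) : 0 < soliton 1 p x := by
  rw [soliton_one_eq]
  exact mul_pos (solitonMax_pos p) (Real.rpow_pos_of_pos (Real.cosh_pos _) _)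

theorem soliton_zero (p : ℕ) : soliton 1 p 0 = solitonMax p := by
  rw [soliton_one_eq]; simp

theorem soliton_neg (p : ℕ) (x : ℝ) : soliton 1 p (-x) = soliton 1 p x := by
  rw [soliton_one_eq, soliton_one_eq, mul_neg, Real.cosh_neg]

theorem soliton_pow {p : ℕ} (hp : 1 ≤ p) (x : ℝ) :
    soliton 1 p x ^ p
      = ((p : ℝ) + 1) * ((p : ℝ) + 2) / 2 * (1 - Real.tanh ((p : ℝ) / 2 * x) ^ 2) := by
  have hp0 : (p : ℝ) ≠ 0 := by positivity
  have hc := Real.cosh_pos ((p : ℝ) / 2 * x)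
  rw [soliton_one_eq, mul_pow, solitonMax_pow hp, ← Real.rpow_mul_natCast hc.le]
  congr 1
  rw [show -(2 / (p : ℝ)) * p = ((-2 : ℤ) : ℝ) by push_cast; field_simp, Real.rpow_intCast,
    Real.tanh_eq_sinh_div_cosh]
  have := Real.cosh_sq ((p : ℝ) / 2 * x)
  field_simp
  have h2 : (p : ℝ) / 2 * x = p * x / 2 := by ring
  rw [h2] at this
  linarith

theorem hasDerivAt_soliton {p : ℕ} (hp : 1 ≤ p) (x : ℝ) :
    HasDerivAt (soliton 1 p) (soliton' p x) x := by
  have hp0 : (p : ℝ) ≠ 0 := by positivity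
  have hc := Real.cosh_pos ((p : ℝ) / 2 * x)
  have h1 : HasDerivAt (fun x => Real.cosh ((p : ℝ) / 2 * x))
      (Real.sinh ((p : ℝ) / 2 * x) * ((p : ℝ) / 2)) x := by
    simpa using ((hasDerivAt_id x).const_mul ((p : ℝ) / 2)).cosh
  have h2 := (h1.rpow_const (p := -(2 / (p : ℝ))) (Or.inl hc.ne')).const_mul (solitonMax p)
  have h3 : soliton 1 p = fun x =>
      solitonMax p * (Real.cosh ((p : ℝ) / 2 * x)) ^ (-(2 / (p : ℝ))) :=
    funext fun x => soliton_one_eq p x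
  rw [soliton', soliton_one_eq, h3]
  refine h2.congr_deriv ?_
  rw [Real.rpow_sub_one hc.ne', Real.tanh_eq_sinh_div_cosh]
  field_simp

theorem hasDerivAt_tanh (x : ℝ) : HasDerivAt Real.tanh (1 - Real.tanh x ^ 2) x := by
  have hc := Real.cosh_pos x
  have h := (Real.hasDerivAt_sinh x).div (Real.hasDerivAt_cosh x) hc.ne'
  have h3 : Real.tanh = fun x => Real.sinh x / Real.cosh x :=
    funext fun x => Real.tanh_eq_sinh_div_cosh x
  rw [Real.tanh_eq_sinh_div_cosh, h3]
  refine h.congr_deriv ?_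
  field_simp

theorem hasDerivAt_soliton' {p : ℕ} (hp : 1 ≤ p) (x : ℝ) :
    HasDerivAt (soliton' p) (soliton'' p x) x := by
  have h1 : HasDerivAt (fun x => Real.tanh ((p : ℝ) / 2 * x))
      ((1 - Real.tanh ((p : ℝ) / 2 * x) ^ 2) * ((p : ℝ) / 2)) x := by
    have := (hasDerivAt_tanh ((p : ℝ) / 2 * x)).comp x ((hasDerivAt_id x).const_mul ((p : ℝ) / 2))
    simpa [Function.comp_def] using this
  have h2 := (h1.mul (hasDerivAt_soliton hp x)).neg
  refine h2.congr_deriv ?_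
  rw [soliton'', soliton', pow_succ (soliton 1 p x), soliton_pow hp]
  field_simp
  ring

/-- The potential `G` in the first integral `φ'² = G(φ)` of the soliton equation. -/
noncomputable def potential (p : ℕ) (s : ℝ) : ℝ :=
  s ^ 2 - 2 / (((p : ℝ) + 1) * ((p : ℝ) + 2)) * s ^ (p + 2)

theorem potential_eq (p : ℕ) (s : ℝ) :
    potential p s = s ^ 2 * (1 - 2 / (((p : ℝ) + 1) * ((p : ℝ) + 2)) * s ^ p) := by
  unfold potential; ring

/-- By `soliton_pow`, the second factor in `potential_eq` is exactly `tanh²`. -/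
theorem soliton'_sq {p : ℕ} (hp : 1 ≤ p) (x : ℝ) :
    soliton' p x ^ 2 = potential p (soliton 1 p x) := by
  rw [potential_eq, soliton_pow hp, soliton']
  field_simp
  ring

theorem soliton_le_exp {p : ℕ} (hp : 1 ≤ p) (x : ℝ) :
    soliton 1 p x ≤ solitonMax p * 2 ^ (2 / (p : ℝ)) * Real.exp (-|x|) := by
  have hp0 : (0 : ℝ) < (p : ℝ) := by exact_mod_cast hp
  have hc := Real.cosh_pos ((p : ℝ) / 2 * x)
  rw [soliton_one_eq, mul_assoc]
  refine mul_le_mul_of_nonneg_left ?_ (solitonMax_pos p).le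
  have h1 : Real.exp ((p : ℝ) / 2 * |x|) / 2 ≤ Real.cosh ((p : ℝ) / 2 * x) := by
    rw [← Real.cosh_abs, abs_mul, abs_of_pos (by positivity : (0 : ℝ) < (p : ℝ) / 2), Real.cosh_eq]
    have := Real.exp_pos (-((p : ℝ) / 2 * |x|))
    linarith
  calc Real.cosh ((p : ℝ) / 2 * x) ^ (-(2 / (p : ℝ)))
      ≤ (Real.exp ((p : ℝ) / 2 * |x|) / 2) ^ (-(2 / (p : ℝ))) :=
        Real.rpow_le_rpow_of_nonpos (by positivity) h1 (neg_nonpos.2 (by positivity))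
    _ = 2 ^ (2 / (p : ℝ)) * Real.exp (-|x|) := by
        rw [Real.div_rpow (Real.exp_pos _).le (by norm_num), ← Real.exp_mul,
          Real.rpow_neg (by norm_num : (0 : ℝ) ≤ 2), div_inv_eq_mul, mul_comm]
        congr 2
        field_simp

theorem memLp_soliton {p : ℕ} (hp : 1 ≤ p) : MemLp (soliton 1 p) 2 volume := by
  have hcont : Continuous (soliton 1 p) :=
    continuous_iff_continuousAt.2 fun x => (hasDerivAt_soliton hp x).continuousAt
  rw [memLp_two_iff_integrable_sq hcont.aestronglyMeasurable]
  set C := solitonMax p * 2 ^ (2 / (p : ℝ)) with hC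
  have hC0 : 0 < C := mul_pos (solitonMax_pos p) (by positivity)
  refine (integrable_inv_one_add_sq.const_mul (C ^ 2)).mono' (hcont.pow 2).aestronglyMeasurable
    (ae_of_all _ fun x => ?_)
  rw [Real.norm_eq_abs, abs_of_nonneg (by positivity)]
  calc soliton 1 p x ^ 2 ≤ (C * Real.exp (-|x|)) ^ 2 := by
        have := soliton_pos p x
        have := soliton_le_exp hp x
        gcongr
    _ = C ^ 2 * (Real.exp |x| ^ 2)⁻¹ := by rw [Real.exp_neg]; ring
    _ ≤ C ^ 2 * (1 + x ^ 2)⁻¹ := by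
        gcongr
        have := Real.add_one_le_exp |x|
        rw [← sq_abs x]
        nlinarith [abs_nonneg x]

theorem h1Pair_of_hasDerivAt {u v : ℝ → ℝ} (h : ∀ x, HasDerivAt u (v x) x) (hv : Continuous v)
    (h1 : MemLp u 2 volume) (h2 : MemLp v 2 volume) : H1Pair u v :=
  ⟨h1, h2, IsPrim.of_hasDerivAt h hv⟩

theorem continuous_soliton {p : ℕ} (hp : 1 ≤ p) : Continuous (soliton 1 p) :=
  continuous_iff_continuousAt.2 fun x => (hasDerivAt_soliton hp x).continuousAt

theorem continuous_soliton' {p : ℕ} (hp : 1 ≤ p) : Continuous (soliton' p) :=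
  continuous_iff_continuousAt.2 fun x => (hasDerivAt_soliton' hp x).continuousAt

theorem h1Pair_soliton {p : ℕ} (hp : 1 ≤ p) : H1Pair (soliton 1 p) (soliton' p) := by
  refine h1Pair_of_hasDerivAt (hasDerivAt_soliton hp) (continuous_soliton' hp)
    (memLp_soliton hp) ((memLp_soliton hp).mono
      (continuous_soliton' hp).aestronglyMeasurable (ae_of_all _ fun x => ?_))
  rw [soliton', norm_neg, norm_mul]
  exact mul_le_of_le_one_left (norm_nonneg _) (Real.abs_tanh_lt_one _).le

theorem H1Pair.memLp_pow_succ {u v : ℝ → ℝ} (h : H1Pair u v) (p : ℕ) :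
    MemLp (fun x => u x ^ (p + 1)) 2 volume := by
  refine (memLp_two_iff_integrable_sq (h.continuous.pow _).aestronglyMeasurable).2 ?_
  refine (h.integrable_pow (i := (p + 1) * 2) (by omega)).congr (ae_of_all _ fun x => ?_)
  exact pow_mul _ _ _

theorem h1Pair_soliton' {p : ℕ} (hp : 1 ≤ p) : H1Pair (soliton' p) (soliton'' p) := by
  refine h1Pair_of_hasDerivAt (hasDerivAt_soliton' hp) ?_ (h1Pair_soliton hp).memLp' ?_
  · exact (continuous_soliton hp).sub (((continuous_soliton hp).pow _).div_const _)
  · have := ((h1Pair_soliton hp).memLp_pow_succ p).const_mul (((p : ℝ) + 1)⁻¹)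
    refine (memLp_soliton hp).sub (this.ae_eq (ae_of_all _ fun x => ?_))
    simp [div_eq_inv_mul]

theorem constraintK_soliton_pos {p : ℕ} (hp : 1 ≤ p) : 0 < constraintK p (soliton 1 p) := by
  refine mul_pos (by positivity) ?_
  refine (integral_pos_iff_support_of_nonneg (fun x => (pow_pos (soliton_pos p x) _).le)
    ((h1Pair_soliton hp).integrable_pow (by omega))).2 ?_
  have : Function.support (fun x => soliton 1 p x ^ (p + 2)) = univ :=
    eq_univ_of_forall fun x => (pow_pos (soliton_pos p x) _).ne'
  rw [this]
  simp

theorem integral_soliton_pow (p : ℕ) : ∫ x, soliton 1 p x ^ (p + 2)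
    = ((p : ℝ) + 1) * ((p : ℝ) + 2) * constraintK p (soliton 1 p) := by
  unfold constraintK
  field_simp

/-- Two linear relations determine the integrals in terms of `β`: pairing the equation with the
soliton gives `∫ φ'² + ∫ φ² = (p + 2) β`, and integrating the first integral gives `∫ φ'² = ∫ φ² -
2β`. -/
theorem integral_soliton'_sq {p : ℕ} (hp : 1 ≤ p) :
    ∫ x, soliton' p x ^ 2 = p / 2 * constraintK p (soliton 1 p) := by
  have hφ := h1Pair_soliton hp
  have hq := hφ.integrable_pow (i := p + 2) (by omega)
  have h1 := hφ.integral_mul_add_mul (h1Pair_soliton' hp)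
  have e1 : ∀ x, soliton' p x * soliton' p x = soliton' p x ^ 2 := fun x => by ring
  have e2 : ∀ x, soliton 1 p x * soliton'' p x
      = soliton 1 p x ^ 2 - 1 / ((p : ℝ) + 1) * soliton 1 p x ^ (p + 2) := fun x => by
    unfold soliton''; ring
  simp_rw [e1, e2] at h1
  rw [integral_sub hφ.integrable_sq (hq.const_mul _), integral_const_mul,
    integral_soliton_pow] at h1
  have h2 : ∫ x, soliton' p x ^ 2 = ∫ x, (soliton 1 p x ^ 2
      - 2 / (((p : ℝ) + 1) * ((p : ℝ) + 2)) * soliton 1 p x ^ (p + 2)) :=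
    integral_congr_ae (ae_of_all _ fun x => soliton'_sq hp x)
  rw [integral_sub hφ.integrable_sq (hq.const_mul _), integral_const_mul,
    integral_soliton_pow] at h2
  have e3 : 1 / ((p : ℝ) + 1) * (((p : ℝ) + 1) * ((p : ℝ) + 2) * constraintK p (soliton 1 p))
      = ((p : ℝ) + 2) * constraintK p (soliton 1 p) := by field_simp
  have e4 : 2 / (((p : ℝ) + 1) * ((p : ℝ) + 2)) *
      (((p : ℝ) + 1) * ((p : ℝ) + 2) * constraintK p (soliton 1 p))
      = 2 * constraintK p (soliton 1 p) := by field_simp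
  rw [e3] at h1
  rw [e4] at h2
  linarith

theorem integral_soliton_energy {p : ℕ} (hp : 1 ≤ p) :
    ∫ x, (soliton 1 p x ^ 2 + soliton' p x ^ 2)
      = ((p : ℝ) + 2) * constraintK p (soliton 1 p) := by
  have hφ := h1Pair_soliton hp
  have hq := hφ.integrable_pow (i := p + 2) (by omega)
  have h2 : ∫ x, soliton' p x ^ 2 = ∫ x, (soliton 1 p x ^ 2
      - 2 / (((p : ℝ) + 1) * ((p : ℝ) + 2)) * soliton 1 p x ^ (p + 2)) :=
    integral_congr_ae (ae_of_all _ fun x => soliton'_sq hp x)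
  rw [integral_sub hφ.integrable_sq (hq.const_mul _), integral_const_mul,
    integral_soliton_pow] at h2
  have e4 : 2 / (((p : ℝ) + 1) * ((p : ℝ) + 2)) *
      (((p : ℝ) + 1) * ((p : ℝ) + 2) * constraintK p (soliton 1 p))
      = 2 * constraintK p (soliton 1 p) := by field_simp
  rw [e4] at h2
  rw [integral_add hφ.integrable_sq hφ.integrable_sq']
  have := integral_soliton'_sq hp
  linarith

/-! ### Sharp lower bounds of the energy on half lines, on the line and for even functions -/

/-- The square root of the potential, extended evenly. -/
noncomputable def sqrtPotential (p : ℕ) (s : ℝ) : ℝ := √(potential p |s|)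

/-- The primitive of `sqrtPotential` vanishing at the origin. -/
noncomputable def primSqrtPotential (p : ℕ) (s : ℝ) : ℝ := ∫ σ in (0 : ℝ)..s, sqrtPotential p σ

theorem continuous_sqrtPotential (p : ℕ) : Continuous (sqrtPotential p) := by
  unfold sqrtPotential potential
  fun_prop

theorem hasDerivAt_primSqrtPotential (p : ℕ) (s : ℝ) :
    HasDerivAt (primSqrtPotential p) (sqrtPotential p s) s :=
  intervalIntegral.integral_hasDerivAt_right
    ((continuous_sqrtPotential p).intervalIntegrable _ _)
    ((continuous_sqrtPotential p).stronglyMeasurableAtFilter _ _)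
    (continuous_sqrtPotential p).continuousAt

theorem continuous_primSqrtPotential (p : ℕ) : Continuous (primSqrtPotential p) :=
  continuous_iff_continuousAt.2 fun s => (hasDerivAt_primSqrtPotential p s).continuousAt

theorem primSqrtPotential_zero (p : ℕ) : primSqrtPotential p 0 = 0 := by
  simp [primSqrtPotential]

theorem sqrtPotential_le (p : ℕ) (s : ℝ) : sqrtPotential p s ≤ |s| := by
  refine Real.sqrt_le_iff.2 ⟨abs_nonneg s, ?_⟩
  unfold potential
  have : 0 ≤ 2 / (((p : ℝ) + 1) * ((p : ℝ) + 2)) * |s| ^ (p + 2) := by positivity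
  linarith

/-- This turns the boundary value of the primitive at the end of a half line into the term `u(c)² /
2`, whatever the sign of `u(c)`. -/
theorem primSqrtPotential_le (p : ℕ) (s : ℝ) : primSqrtPotential p s ≤ s ^ 2 / 2 := by
  rcases le_total 0 s with hs | hs
  · calc primSqrtPotential p s ≤ ∫ σ in (0 : ℝ)..s, σ := by
          refine intervalIntegral.integral_mono_on hs
            ((continuous_sqrtPotential p).intervalIntegrable _ _)
            (continuous_id.intervalIntegrable _ _) fun x hx => ?_
          simpa [abs_of_nonneg hx.1] using sqrtPotential_le p x
      _ = s ^ 2 / 2 := by rw [integral_id]; ring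
  · have h1 : 0 ≤ ∫ σ in s..(0 : ℝ), sqrtPotential p σ :=
      intervalIntegral.integral_nonneg hs fun x _ => Real.sqrt_nonneg _
    unfold primSqrtPotential
    rw [intervalIntegral.integral_symm]
    have := sq_nonneg s
    linarith

/-- The height of the soliton is the positive zero of the potential. Below it the real square root
is a true square root, which is why competitors are rescaled to this height. -/
theorem potential_nonneg {p : ℕ} (hp : 1 ≤ p) {s : ℝ} (h0 : 0 ≤ s) (hs : s ≤ solitonMax p) :
    0 ≤ potential p s := by
  rw [potential_eq]
  refine mul_nonneg (sq_nonneg s) ?_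
  have h1 : s ^ p ≤ ((p : ℝ) + 1) * ((p : ℝ) + 2) / 2 := by
    rw [← solitonMax_pow hp]; gcongr
  have h2 : 2 / (((p : ℝ) + 1) * ((p : ℝ) + 2)) * s ^ p
      ≤ 2 / (((p : ℝ) + 1) * ((p : ℝ) + 2)) * (((p : ℝ) + 1) * ((p : ℝ) + 2) / 2) := by gcongr
  have h3 : 2 / (((p : ℝ) + 1) * ((p : ℝ) + 2)) * (((p : ℝ) + 1) * ((p : ℝ) + 2) / 2) = 1 := by
    field_simp
  linarith

/-- On `x > 0` the soliton decreases from its maximum to `0` and `√G(φ) φ' = -φ'²`. Integrating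
gives half of `∫ φ'²`: the soliton attains equality in the arithmetic-geometric bound on the action.
-/
theorem primSqrtPotential_max {p : ℕ} (hp : 1 ≤ p) :
    primSqrtPotential p (solitonMax p) = p / 4 * constraintK p (soliton 1 p) := by
  have hφ := h1Pair_soliton hp
  have hF := hφ.prim.comp (hasDerivAt_primSqrtPotential p) (continuous_sqrtPotential p)
  have hlim : Tendsto (fun x => primSqrtPotential p (soliton 1 p x)) atTop (𝓝 0) := by
    have := ((continuous_primSqrtPotential p).tendsto 0).comp hφ.tendsto_atTop
    rwa [primSqrtPotential_zero] at this
  have heq : ∀ x ∈ Ioi (0 : ℝ), -(soliton' p x ^ 2)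
      = sqrtPotential p (soliton 1 p x) * soliton' p x := by
    intro x hx
    have h1 : soliton' p x ≤ 0 := by
      unfold soliton'
      have h2 : 0 ≤ Real.tanh ((p : ℝ) / 2 * x) := by
        rw [Real.tanh_eq_sinh_div_cosh]
        have : 0 ≤ Real.sinh ((p : ℝ) / 2 * x) := by
          rw [Real.sinh_nonneg_iff]
          have : (0 : ℝ) < x := hx
          positivity
        exact div_nonneg this (Real.cosh_pos _).le
      have := mul_nonneg h2 (soliton_pos p x).le
      linarith
    rw [sqrtPotential, abs_of_pos (soliton_pos p x), ← soliton'_sq hp, Real.sqrt_sq_eq_abs,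
      abs_of_nonpos h1]
    ring
  have hint : IntegrableOn (fun x => sqrtPotential p (soliton 1 p x) * soliton' p x) (Ioi 0) :=
    IntegrableOn.congr_fun hφ.integrable_sq'.neg.integrableOn heq measurableSet_Ioi
  have h1 := intervalIntegral_tendsto_integral_Ioi 0 hint tendsto_id
  have h2 := tendsto_nhds_unique h1 ((hlim.sub_const _).congr fun x => hF.2 0 x)
  rw [← setIntegral_congr_fun measurableSet_Ioi heq, integral_neg] at h2
  simp only [soliton_zero] at h2
  have h3 : ∫ x, soliton' p x ^ 2 = 2 * ∫ x in Ioi (0 : ℝ), soliton' p x ^ 2 := by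
    rw [← integral_comp_abs (f := fun x => soliton' p x ^ 2)]
    refine integral_congr_ae (ae_of_all _ fun x => ?_)
    rcases abs_choice x with h | h
    · simp [h]
    · simp only [h, soliton', mul_neg, Real.tanh_neg, soliton_neg]
      ring
  have h4 := integral_soliton'_sq hp
  linarith

theorem H1Pair.integrable_abs_pow {u v : ℝ → ℝ} (h : H1Pair u v) {i : ℕ} (hi : 2 ≤ i) :
    Integrable (fun x => |u x| ^ i) :=
  (h.integrable_pow hi).norm.congr (ae_of_all _ fun x => by simp)

theorem H1Pair.integrable_energy {u v : ℝ → ℝ} (h : H1Pair u v) :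
    Integrable (fun x => 1 / 2 * v x ^ 2 + 1 / 2 * u x ^ 2) :=
  (h.integrable_sq'.const_mul _).add (h.integrable_sq.const_mul _)

/-- The lower bound of the action on a half line by the action of the soliton. -/
theorem action_half_line_ge {p : ℕ} (hp : 1 ≤ p) {u v : ℝ → ℝ} (h : H1Pair u v) {c x₀ : ℝ}
    (hx₀ : c ≤ x₀) (hle : ∀ x, c ≤ x → |u x| ≤ solitonMax p) (hmax : u x₀ = solitonMax p) :
    p / 2 * constraintK p (soliton 1 p) - u c ^ 2 / 2 ≤
      (∫ x in Ioi c, (1 / 2 * v x ^ 2 + 1 / 2 * u x ^ 2))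
        - 1 / (((p : ℝ) + 1) * ((p : ℝ) + 2)) * ∫ x in Ioi c, |u x| ^ (p + 2) := by
  set D : ℝ → ℝ := fun x => (1 / 2 * v x ^ 2 + 1 / 2 * u x ^ 2)
    - 1 / (((p : ℝ) + 1) * ((p : ℝ) + 2)) * |u x| ^ (p + 2) with hD
  have hi2 := (h.integrable_abs_pow (i := p + 2) (by omega)).const_mul
    (1 / (((p : ℝ) + 1) * ((p : ℝ) + 2)))
  have hDi : Integrable D := h.integrable_energy.sub hi2
  have hF := h.prim.comp (hasDerivAt_primSqrtPotential p) (continuous_sqrtPotential p)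
  have hDeq : ∀ x, D x = 1 / 2 * (v x ^ 2 + potential p |u x|) := by
    intro x
    simp only [hD, potential, sq_abs]
    ring
  -- Completing the square: with `s = √G(|u|)`, the density `(v² + s²) / 2` dominates `|s v|`.
  have hpt : ∀ x, c ≤ x → |sqrtPotential p (u x) * v x| ≤ D x := by
    intro x hx
    have h1 : sqrtPotential p (u x) ^ 2 = potential p |u x| :=
      Real.sq_sqrt (potential_nonneg hp (abs_nonneg _) (hle x hx))
    rw [hDeq, ← h1, abs_le]
    constructor
    · nlinarith [sq_nonneg (v x + sqrtPotential p (u x))]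
    · nlinarith [sq_nonneg (v x - sqrtPotential p (u x))]
  -- The path rises from `u c` to the maximum on `[c, x₀]` and descends to `u R` on `[x₀, R]`. The
  -- maximum is therefore counted twice; then `R → ∞`.
  have hR : ∀ R, x₀ ≤ R → 2 * primSqrtPotential p (solitonMax p) - primSqrtPotential p (u c)
      - primSqrtPotential p (u R) ≤ ∫ x in c..R, D x := by
    intro R hR
    have h1 : primSqrtPotential p (u x₀) - primSqrtPotential p (u c) ≤ ∫ x in c..x₀, D x := by
      rw [hF.2]
      refine intervalIntegral.integral_mono_on hx₀ (hF.intervalIntegrable _ _)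
        hDi.intervalIntegrable fun x hx => (le_abs_self _).trans (hpt x hx.1)
    have h2 : -(primSqrtPotential p (u R) - primSqrtPotential p (u x₀)) ≤ ∫ x in x₀..R, D x := by
      rw [hF.2, ← intervalIntegral.integral_neg]
      refine intervalIntegral.integral_mono_on hR (hF.intervalIntegrable _ _).neg
        hDi.intervalIntegrable fun x hx => (neg_le_abs _).trans (hpt x (hx₀.trans hx.1))
    have h3 := intervalIntegral.integral_add_adjacent_intervals
      (hDi.intervalIntegrable (a := c) (b := x₀)) (hDi.intervalIntegrable (a := x₀) (b := R))
    rw [hmax] at h1 h2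
    linarith
  have hlimF : Tendsto (fun x => primSqrtPotential p (u x)) atTop (𝓝 0) := by
    have := ((continuous_primSqrtPotential p).tendsto 0).comp h.tendsto_atTop
    rwa [primSqrtPotential_zero] at this
  have hlimD := intervalIntegral_tendsto_integral_Ioi c hDi.integrableOn tendsto_id
  have hfin := le_of_tendsto_of_tendsto (hlimF.const_sub
    (2 * primSqrtPotential p (solitonMax p) - primSqrtPotential p (u c))) hlimD
    ((eventually_ge_atTop x₀).mono hR)
  have hsplit : ∫ x in Ioi c, D x = (∫ x in Ioi c, (1 / 2 * v x ^ 2 + 1 / 2 * u x ^ 2))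
        - 1 / (((p : ℝ) + 1) * ((p : ℝ) + 2)) * ∫ x in Ioi c, |u x| ^ (p + 2) := by
    rw [hD, integral_sub h.integrable_energy.integrableOn hi2.integrableOn, integral_const_mul]
  rw [hsplit, sub_zero, primSqrtPotential_max hp] at hfin
  have := primSqrtPotential_le p (u c)
  linarith

theorem young_rpow {p : ℕ} (hp : 1 ≤ p) {t κ : ℝ} (ht : 0 < t) (hκ : 0 ≤ κ) :
    κ ^ (2 / ((p : ℝ) + 2)) ≤ p / ((p : ℝ) + 2) * (t ^ 2)⁻¹ + 2 / ((p : ℝ) + 2) * (t ^ p * κ) := by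
  have h := Real.geom_mean_le_arith_mean2_weighted (w₁ := p / ((p : ℝ) + 2))
    (w₂ := 2 / ((p : ℝ) + 2)) (p₁ := (t ^ 2)⁻¹) (p₂ := t ^ p * κ) (by positivity) (by positivity)
    (by positivity) (by positivity) (by field_simp)
  refine le_of_eq_of_le ?_ h
  rw [Real.mul_rpow (by positivity) hκ, ← mul_assoc]
  have h1 : ((t ^ 2)⁻¹) ^ (p / ((p : ℝ) + 2)) * (t ^ p) ^ (2 / ((p : ℝ) + 2)) = 1 := by
    rw [← Real.rpow_natCast t p, ← Real.rpow_natCast t 2, ← Real.rpow_neg ht.le,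
      ← Real.rpow_mul ht.le, ← Real.rpow_mul ht.le, ← Real.rpow_add ht]
    have : -((2 : ℕ) : ℝ) * (p / ((p : ℝ) + 2)) + p * (2 / ((p : ℝ) + 2)) = 0 := by
      push_cast; ring
    rw [this, Real.rpow_zero]
  rw [h1, one_mul]

/-- The sharp inequality on a half line, with the energy of the exponential extension. -/
theorem sharp_half_line {p : ℕ} (hp : 1 ≤ p) {u v : ℝ → ℝ} (h : H1Pair u v) (c : ℝ) :
    ((p : ℝ) + 2) / 2 * constraintK p (soliton 1 p) *
      ((1 / (((p : ℝ) + 1) * ((p : ℝ) + 2)) * ∫ x in Ioi c, |u x| ^ (p + 2))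
        / constraintK p (soliton 1 p)) ^ (2 / ((p : ℝ) + 2)) ≤
      (∫ x in Ioi c, (1 / 2 * v x ^ 2 + 1 / 2 * u x ^ 2)) + u c ^ 2 / 2 := by
  have hβ := constraintK_soliton_pos hp
  set β := constraintK p (soliton 1 p)
  have hE0 : 0 ≤ ∫ x in Ioi c, (1 / 2 * v x ^ 2 + 1 / 2 * u x ^ 2) :=
    integral_nonneg fun x => by positivity
  by_cases hu : ∀ x, c ≤ x → u x = 0
  · have h1 : ∫ x in Ioi c, |u x| ^ (p + 2) = 0 := by
      rw [setIntegral_congr_fun (g := fun _ => (0 : ℝ)) measurableSet_Ioi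
        (fun x hx => by simp [hu x (le_of_lt hx)])]
      simp
    rw [h1, mul_zero, zero_div, Real.zero_rpow (by positivity), mul_zero]
    positivity
  · push Not at hu
    obtain ⟨y, hy, hy0⟩ := hu
    have hlim : Tendsto (fun x => |u x|) (cocompact ℝ) (𝓝 0) := by
      rw [cocompact_eq_atBot_atTop]
      exact (tendsto_sup.2 ⟨(tendsto_zero_iff_abs_tendsto_zero _).1 h.tendsto_atBot,
        (tendsto_zero_iff_abs_tendsto_zero _).1 h.tendsto_atTop⟩)
    obtain ⟨x₀, hx₀, hm⟩ := (h.continuous.abs.continuousOn (s := Ici c)).exists_isMaxOn'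
      isClosed_Ici (x₀ := y) hy
      (((hlim.eventually_le_const (abs_pos.2 hy0))).filter_mono inf_le_left)
    have hux₀ : 0 < |u x₀| := (abs_pos.2 hy0).trans_le (hm hy)
    have hu0 : u x₀ ≠ 0 := abs_pos.1 hux₀
    have hM := solitonMax_pos p
    -- The factor is negative when `u x₀` is, so `t * u` equals exactly `solitonMax p` at `x₀` and
    -- has modulus at most that on the half line.
    set t := solitonMax p / u x₀ with ht
    have ht0 : 0 < |t| := by rw [ht, abs_div]; exact div_pos (abs_pos.2 hM.ne') hux₀
    have key := action_half_line_ge hp (h.const_mul t) (c := c) (x₀ := x₀) hx₀ (fun x hx => by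
      rw [abs_mul, ht, abs_div, abs_of_pos hM, div_mul_eq_mul_div]
      exact div_le_of_le_mul₀ hux₀.le hM.le (mul_le_mul_of_nonneg_left (hm hx) hM.le)) (by
      rw [ht]; field_simp)
    have e1 : ∀ x, 1 / 2 * (t * v x) ^ 2 + 1 / 2 * (t * u x) ^ 2
        = |t| ^ 2 * (1 / 2 * v x ^ 2 + 1 / 2 * u x ^ 2) := fun x => by rw [sq_abs]; ring
    have e2 : ∀ x, |t * u x| ^ (p + 2) = |t| ^ (p + 2) * |u x| ^ (p + 2) := fun x => by
      rw [abs_mul, mul_pow]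
    simp_rw [e1, e2] at key
    rw [integral_const_mul, integral_const_mul, mul_pow, ← sq_abs t] at key
    set A := ∫ x in Ioi c, (1 / 2 * v x ^ 2 + 1 / 2 * u x ^ 2)
    have hk0 : 0 ≤ ∫ x in Ioi c, |u x| ^ (p + 2) := integral_nonneg fun x => by positivity
    set k := ∫ x in Ioi c, |u x| ^ (p + 2)
    set r := 1 / (((p : ℝ) + 1) * ((p : ℝ) + 2)) with hr
    have hr0 : 0 < r := by positivity
    -- The factor `t` depends on `u`; Young's inequality removes it, since the weights make the
    -- powers of `t` cancel in the geometric mean.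
    have hy := young_rpow hp ht0 (κ := r * k / β) (by positivity)
    set τ := |t|
    have h3 : (τ ^ 2)⁻¹ * (p / 2 * β) + τ ^ p * (r * k) ≤ A + u c ^ 2 / 2 := by
      have h4 : p / 2 * β + τ ^ 2 * (τ ^ p * (r * k)) ≤ τ ^ 2 * (A + u c ^ 2 / 2) := by
        have : r * (τ ^ (p + 2) * k) = τ ^ 2 * (τ ^ p * (r * k)) := by ring
        linarith
      have h5 := mul_le_mul_of_nonneg_left h4 (inv_nonneg.2 (sq_nonneg τ))
      have h6 : (τ ^ 2)⁻¹ * τ ^ 2 = 1 := inv_mul_cancel₀ (by positivity)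
      rw [mul_add, ← mul_assoc _ (τ ^ 2), ← mul_assoc _ (τ ^ 2), h6, one_mul, one_mul] at h5
      exact h5
    refine le_trans (mul_le_mul_of_nonneg_left hy (by positivity)) (le_of_eq_of_le ?_ h3)
    field_simp

theorem abs_constraintK_le (p : ℕ) (u : ℝ → ℝ) :
    |constraintK p u| ≤ 1 / (((p : ℝ) + 1) * ((p : ℝ) + 2)) * ∫ x, |u x| ^ (p + 2) := by
  unfold constraintK
  rw [abs_mul, abs_of_nonneg (by positivity : (0 : ℝ) ≤ 1 / (((p : ℝ) + 1) * ((p : ℝ) + 2)))]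
  gcongr
  refine (abs_integral_le_integral_abs).trans (le_of_eq ?_)
  simp_rw [abs_pow]

/-- The sharp inequality on the line. -/
theorem sharp_line {p : ℕ} (hp : 1 ≤ p) {u v : ℝ → ℝ} (h : H1Pair u v) :
    ((p : ℝ) + 2) / 2 * constraintK p (soliton 1 p) *
      (|constraintK p u| / constraintK p (soliton 1 p)) ^ (2 / ((p : ℝ) + 2)) ≤
      ∫ x, (1 / 2 * v x ^ 2 + 1 / 2 * u x ^ 2) := by
  have hβ := constraintK_soliton_pos hp
  -- The half line is exhausted to the whole line as `c → -∞`, and the endpoint term vanishes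
  -- because `u` decays.
  have hc : AECover (volume : Measure ℝ) atBot (fun c : ℝ => Ioi c) := aecover_Ioi tendsto_id
  have h1 := hc.integral_tendsto_of_countably_generated
    (h.integrable_abs_pow (i := p + 2) (by omega))
  have h2 := hc.integral_tendsto_of_countably_generated h.integrable_energy
  have h3 : Tendsto (fun c => u c ^ 2 / 2) atBot (𝓝 0) := by
    simpa using (h.tendsto_atBot.pow 2).div_const 2
  have h4 := le_of_tendsto_of_tendsto
    ((((h1.const_mul (1 / (((p : ℝ) + 1) * ((p : ℝ) + 2)))).div_const
      (constraintK p (soliton 1 p))).rpow_const (p := 2 / ((p : ℝ) + 2))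
        (Or.inr (by positivity))).const_mul
      (((p : ℝ) + 2) / 2 * constraintK p (soliton 1 p)))
    (h2.add h3) (Eventually.of_forall fun c => sharp_half_line hp h c)
  rw [add_zero] at h4
  refine le_trans ?_ h4
  gcongr
  exact abs_constraintK_le p u

/-- The sharp inequality for even functions, with the constant of two separated bumps. -/
theorem sharp_even {p : ℕ} (hp : 1 ≤ p) {u v : ℝ → ℝ} (h : H1Pair u v)
    (he : ∀ x, u (-x) = u x) :
    2 * (((p : ℝ) + 2) / 2 * constraintK p (soliton 1 p) *
      (|constraintK p u| / (2 * constraintK p (soliton 1 p))) ^ (2 / ((p : ℝ) + 2))) ≤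
      (∫ x, (1 / 2 * v x ^ 2 + 1 / 2 * u x ^ 2)) + u 0 ^ 2 := by
  have hβ := constraintK_soliton_pos hp
  have h1 := sharp_half_line hp h 0
  have h2 := sharp_half_line hp h.comp_neg 0
  have hE := h.integrable_energy
  have e1 : ∫ x in Ioi (0 : ℝ), (1 / 2 * (-v (-x)) ^ 2 + 1 / 2 * u (-x) ^ 2)
      = ∫ x in Iic (0 : ℝ), (1 / 2 * v x ^ 2 + 1 / 2 * u x ^ 2) := by
    have := integral_comp_neg_Ioi 0 (fun x => 1 / 2 * v x ^ 2 + 1 / 2 * u x ^ 2)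
    simpa using this
  have e2 := intervalIntegral.integral_Iic_add_Ioi (b := (0 : ℝ)) hE.integrableOn hE.integrableOn
  -- Evenness places exactly half of this integral on each side; this is the source of the factor `2
  -- * β` in the denominator.
  have e3 : ∫ x, |u x| ^ (p + 2) = 2 * ∫ x in Ioi (0 : ℝ), |u x| ^ (p + 2) := by
    rw [← integral_comp_abs (f := fun x => |u x| ^ (p + 2))]
    refine integral_congr_ae (ae_of_all _ fun x => ?_)
    rcases abs_choice x with h | h <;> simp [h, he]
  rw [e1] at h2
  simp only [he, neg_zero] at h2
  have h3 : |constraintK p u| / (2 * constraintK p (soliton 1 p)) ≤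
      (1 / (((p : ℝ) + 1) * ((p : ℝ) + 2)) * ∫ x in Ioi (0 : ℝ), |u x| ^ (p + 2))
        / constraintK p (soliton 1 p) := by
    have := abs_constraintK_le p u
    rw [e3] at this
    rw [div_le_div_iff₀ (by positivity) hβ]
    nlinarith
  have h4 := mul_le_mul_of_nonneg_left (Real.rpow_le_rpow (by positivity) h3
    (by positivity : 0 ≤ 2 / ((p : ℝ) + 2)))
    (by positivity : 0 ≤ ((p : ℝ) + 2) / 2 * constraintK p (soliton 1 p))
  linarith

/-! ### Weak convergence in `L²` and compactness in `H^1` -/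

theorem _root_.MeasureTheory.MemLp.inner_toLp {f g : ℝ → ℝ} (hf : MemLp f 2 volume)
    (hg : MemLp g 2 volume) : inner ℝ (hf.toLp f) (hg.toLp g) = ∫ x, f x * g x := by
  rw [L2.inner_def]
  refine integral_congr_ae ?_
  filter_upwards [hf.coeFn_toLp, hg.coeFn_toLp] with x h1 h2
  rw [h1, h2]
  simp [mul_comm]

theorem _root_.MeasureTheory.MemLp.norm_toLp_sq {f : ℝ → ℝ} (hf : MemLp f 2 volume) :
    ‖hf.toLp f‖ ^ 2 = ∫ x, f x ^ 2 := by
  rw [← real_inner_self_eq_norm_sq, hf.inner_toLp hf]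
  simp_rw [sq]

theorem _root_.MeasureTheory.MemLp.norm_toLp_le {f : ℝ → ℝ} (hf : MemLp f 2 volume) {C : ℝ}
    (h : ∫ x, f x ^ 2 ≤ C) : ‖hf.toLp f‖ ≤ √C :=
  Real.le_sqrt_of_sq_le (hf.norm_toLp_sq.trans_le h)

/-- Weak convergence in `L²(ℝ)`. -/
def WeakLim (f : ℕ → ℝ → ℝ) (g : ℝ → ℝ) : Prop :=
  ∀ h : ℝ → ℝ, MemLp h 2 volume → Tendsto (fun n => ∫ x, f n x * h x) atTop (𝓝 (∫ x, g x * h x))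

theorem WeakLim.comp {f : ℕ → ℝ → ℝ} {g : ℝ → ℝ} (h : WeakLim f g) {φ : ℕ → ℕ}
    (hφ : StrictMono φ) : WeakLim (fun n => f (φ n)) g :=
  fun k hk => (h k hk).comp hφ.tendsto_atTop

/-- Bounded sequences in `L²(ℝ)` have weakly convergent subsequences. -/
theorem exists_weakLim {f : ℕ → ℝ → ℝ} (hf : ∀ n, MemLp (f n) 2 volume) {C : ℝ}
    (hC : ∀ n, ∫ x, f n x ^ 2 ≤ C) :
    ∃ (φ : ℕ → ℕ) (g : ℝ → ℝ), StrictMono φ ∧ MemLp g 2 volume ∧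
      WeakLim (fun n => f (φ n)) g := by
  let D := InnerProductSpace.toDual ℝ (Lp ℝ 2 (volume : Measure ℝ))
  let F : ℕ → WeakDual ℝ (Lp ℝ 2 (volume : Measure ℝ)) := fun n =>
    StrongDual.toWeakDual (D ((hf n).toLp (f n)))
  have hmem : ∀ n, F n ∈ WeakDual.toStrongDual ⁻¹' Metric.closedBall
      (0 : StrongDual ℝ (Lp ℝ 2 (volume : Measure ℝ))) (√C) := by
    intro n
    show D ((hf n).toLp (f n)) ∈ Metric.closedBall 0 (√C)
    rw [mem_closedBall_zero_iff, LinearIsometryEquiv.norm_map]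
    exact (hf n).norm_toLp_le (hC n)
  have : Fact ((2 : ENNReal) ≠ ⊤) := ⟨by norm_num⟩
  -- Sequential Banach-Alaoglu in the dual of the separable space `L²`, identified with `L²` by
  -- Riesz.
  obtain ⟨a, -, φ, hφ, hlim⟩ := WeakDual.isSeqCompact_closedBall ℝ _ 0 (√C) hmem
  let G : Lp ℝ 2 (volume : Measure ℝ) := D.symm (WeakDual.toStrongDual a)
  refine ⟨φ, G, hφ, Lp.memLp G, fun h hh => ?_⟩
  have h1 := (WeakDual.eval_continuous (hh.toLp h)).continuousAt.tendsto.comp hlim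
  have e1 : ∀ n, (F n) (hh.toLp h) = ∫ x, f n x * h x := fun n => by
    rw [← (hf n).inner_toLp hh]
    rfl
  have e2 : a (hh.toLp h) = ∫ x, G x * h x := by
    have : WeakDual.toStrongDual a = D G := (D.apply_symm_apply _).symm
    have h2 : a (hh.toLp h) = inner ℝ G (hh.toLp h) := by
      rw [← InnerProductSpace.toDual_apply_apply, ← this]
      rfl
    rw [h2, ← (Lp.memLp G).inner_toLp hh, Lp.toLp_coeFn]
  rw [← e2]
  exact h1.congr fun n => e1 (φ n)

theorem WeakLim.ae_eq {f : ℕ → ℝ → ℝ} {g h : ℝ → ℝ} (hg : WeakLim f g) (hh : WeakLim f h)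
    (hg2 : MemLp g 2 volume) (hh2 : MemLp h 2 volume) : g =ᵐ[volume] h := by
  have hd := hg2.sub hh2
  have h1 := tendsto_nhds_unique (hg _ hd) (hh _ hd)
  have h2 : ∫ x, (g x - h x) ^ 2 = 0 := by
    have : ∀ x, (g x - h x) ^ 2 = g x * (g - h) x - h x * (g - h) x := fun x => by
      simp only [Pi.sub_apply]; ring
    simp_rw [this]
    rw [integral_sub (H1Pair.integrable_mul hg2 hd) (H1Pair.integrable_mul hh2 hd), h1, sub_self]
  have h3 := (integral_eq_zero_iff_of_nonneg (fun x => sq_nonneg (g x - h x)) hd.integrable_sq).1 h2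
  filter_upwards [h3] with x hx
  have : (g x - h x) ^ 2 = 0 := hx
  nlinarith [pow_eq_zero_iff (two_ne_zero) |>.1 this]

/-- The energy of a weakly convergent sequence splits. -/
theorem WeakLim.sq_split {f : ℕ → ℝ → ℝ} {g : ℝ → ℝ} (h : WeakLim f g)
    (hf : ∀ n, MemLp (f n) 2 volume) (hg : MemLp g 2 volume) :
    Tendsto (fun n => (∫ x, f n x ^ 2) - ∫ x, (f n x - g x) ^ 2) atTop (𝓝 (∫ x, g x ^ 2)) := by
  have h1 := ((h g hg).const_mul 2).sub_const (∫ x, g x ^ 2)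
  have e1 : 2 * (∫ x, g x * g x) - ∫ x, g x ^ 2 = ∫ x, g x ^ 2 := by
    simp_rw [← sq]; ring
  rw [e1] at h1
  refine h1.congr fun n => ?_
  have e2 : ∀ x, (f n x - g x) ^ 2 = (f n x ^ 2 - 2 * (f n x * g x)) + g x ^ 2 := fun x => by ring
  have hi := H1Pair.integrable_mul (hf n) hg
  have hi' : Integrable (fun x => f n x ^ 2 - 2 * (f n x * g x)) :=
    (hf n).integrable_sq.sub (hi.const_mul 2)
  simp_rw [e2]
  rw [integral_add hi' hg.integrable_sq,
    integral_sub (hf n).integrable_sq (hi.const_mul 2), integral_const_mul]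
  ring

/-- A bounded sequence in `L²(ℝ)` converging to zero pointwise converges weakly to zero, also
in absolute value. -/
theorem tendsto_integral_abs_mul_abs {r : ℕ → ℝ → ℝ} {g : ℝ → ℝ} (hr : ∀ n, MemLp (r n) 2 volume)
    (hg : MemLp g 2 volume) {C : ℝ} (hC : ∀ n, ∫ x, r n x ^ 2 ≤ C)
    (h0 : ∀ x, Tendsto (fun n => r n x) atTop (𝓝 0)) :
    Tendsto (fun n => ∫ x, |g x| * |r n x|) atTop (𝓝 0) := by
  have hC0 : 0 ≤ C := (integral_nonneg fun x => sq_nonneg _).trans (hC 0)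
  have hint : ∀ n, Integrable (fun x => |g x| * |r n x|) := fun n =>
    (H1Pair.integrable_mul hg (hr n)).norm.congr (ae_of_all _ fun x => by
      simp only [norm_mul, Real.norm_eq_abs])
  rw [Metric.tendsto_atTop]
  intro ε hε
  set δ := ε / (2 * (C + 1)) with hδ
  have hδ0 : 0 < δ := by positivity
  -- The excess of `|g| |r n|` over `δ (r n)²` is dominated by the fixed integrable function `g² /
  -- (4δ)`, so dominated convergence applies to it; the part `δ ∫ (r n)²` is small by the uniform
  -- bound.
  have hdct : Tendsto (fun n => ∫ x, max (|g x| * |r n x| - δ * r n x ^ 2) 0) atTop (𝓝 0) := by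
    have : Tendsto (fun n => ∫ x, max (|g x| * |r n x| - δ * r n x ^ 2) 0) atTop
        (𝓝 (∫ _ : ℝ, (0 : ℝ))) := by
      refine tendsto_integral_of_dominated_convergence (fun x => (4 * δ)⁻¹ * g x ^ 2) ?_ ?_ ?_ ?_
      · exact fun n => (((hint n).sub ((hr n).integrable_sq.const_mul δ)).aestronglyMeasurable).sup
          aestronglyMeasurable_const
      · exact hg.integrable_sq.const_mul _
      · refine fun n => ae_of_all _ fun x => ?_
        rw [Real.norm_eq_abs, abs_of_nonneg (le_max_right _ _)]
        refine max_le ?_ (by positivity)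
        rw [inv_mul_eq_div, le_div_iff₀ (by positivity), ← sq_abs (g x), ← sq_abs (r n x)]
        nlinarith [sq_nonneg (|g x| - 2 * δ * |r n x|)]
      · refine ae_of_all _ fun x => ?_
        have h1 := ((h0 x).abs.const_mul |g x|).sub (((h0 x).pow 2).const_mul δ)
        have h2 := h1.max (tendsto_const_nhds (x := (0 : ℝ)))
        simpa using h2
    simpa using this
  obtain ⟨N, hN⟩ := Metric.tendsto_atTop.1 hdct (ε / 2) (by positivity)
  refine ⟨N, fun n hn => ?_⟩
  have h1 := hN n hn
  rw [Real.dist_eq, sub_zero] at h1 ⊢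
  rw [abs_of_nonneg (integral_nonneg fun x => by positivity)]
  have hi2 : Integrable (fun x => max (|g x| * |r n x| - δ * r n x ^ 2) 0) :=
    ((hint n).sub ((hr n).integrable_sq.const_mul δ)).pos_part
  have hi3 := (hr n).integrable_sq.const_mul δ
  calc ∫ x, |g x| * |r n x|
      ≤ ∫ x, (max (|g x| * |r n x| - δ * r n x ^ 2) 0 + δ * r n x ^ 2) :=
        integral_mono (hint n) (hi2.add hi3) fun x => by
          have := le_max_left (|g x| * |r n x| - δ * r n x ^ 2) 0
          show |g x| * |r n x| ≤ _
          linarith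
    _ = (∫ x, max (|g x| * |r n x| - δ * r n x ^ 2) 0) + δ * ∫ x, r n x ^ 2 := by
        rw [integral_add hi2 hi3, integral_const_mul]
    _ < ε / 2 + δ * (C + 1) := by
        refine add_lt_add_of_lt_of_le ((le_abs_self _).trans_lt h1) ?_
        gcongr
        linarith [hC n]
    _ = ε := by rw [hδ]; field_simp; ring

theorem weakLim_of_tendsto {f : ℕ → ℝ → ℝ} {g : ℝ → ℝ} (hf : ∀ n, MemLp (f n) 2 volume)
    (hg : MemLp g 2 volume) {C : ℝ} (hC : ∀ n, ∫ x, f n x ^ 2 ≤ C)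
    (h : ∀ x, Tendsto (fun n => f n x) atTop (𝓝 (g x))) : WeakLim f g := by
  intro k hk
  have h1 := tendsto_integral_abs_mul_abs (fun n => (hf n).sub hg) hk
    (C := 2 * C + 2 * ∫ x, g x ^ 2) (fun n => by
      have hi := ((hf n).integrable_sq.const_mul 2).add (hg.integrable_sq.const_mul 2)
      calc ∫ x, (f n - g) x ^ 2 ≤ ∫ x, (2 * f n x ^ 2 + 2 * g x ^ 2) :=
            integral_mono ((hf n).sub hg).integrable_sq hi fun x => by
              simp only [Pi.sub_apply]
              nlinarith [sq_nonneg (f n x + g x)]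
        _ = 2 * (∫ x, f n x ^ 2) + 2 * ∫ x, g x ^ 2 := by
            rw [integral_add ((hf n).integrable_sq.const_mul 2) (hg.integrable_sq.const_mul 2),
              integral_const_mul, integral_const_mul]
        _ ≤ _ := by linarith [hC n])
    (fun x => by simpa using (h x).sub_const (g x))
  rw [tendsto_iff_norm_sub_tendsto_zero]
  refine squeeze_zero (fun n => norm_nonneg _) (fun n => ?_) h1
  rw [← integral_sub (H1Pair.integrable_mul (hf n) hk) (H1Pair.integrable_mul hg hk)]
  refine (norm_integral_le_integral_norm _).trans (le_of_eq ?_)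
  refine integral_congr_ae (ae_of_all _ fun x => ?_)
  show ‖f n x * k x - g x * k x‖ = |k x| * |f n x - g x|
  rw [← sub_mul, norm_mul, Real.norm_eq_abs, Real.norm_eq_abs, mul_comm]

/-- Fatou's lemma for the `L²` norm. -/
theorem memLp_of_tendsto {f : ℕ → ℝ → ℝ} {g : ℝ → ℝ} (hf : ∀ n, MemLp (f n) 2 volume)
    {C : ℝ} (hC : ∀ n, ∫ x, f n x ^ 2 ≤ C)
    (h : ∀ x, Tendsto (fun n => f n x) atTop (𝓝 (g x))) : MemLp g 2 volume := by
  refine ⟨aestronglyMeasurable_of_tendsto_ae atTop (fun n => (hf n).1) (ae_of_all _ h), ?_⟩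
  refine lt_of_le_of_lt (Lp.eLpNorm_lim_le_liminf_eLpNorm (fun n => (hf n).1) g (ae_of_all _ h))
    (lt_of_le_of_lt (liminf_le_of_frequently_le' (x := ENNReal.ofReal (√C)) ?_)
      ENNReal.ofReal_lt_top)
  refine Frequently.of_forall fun n => ?_
  rw [ENNReal.le_ofReal_iff_toReal_le (hf n).2.ne (Real.sqrt_nonneg _), ← Lp.norm_toLp _ (hf n)]
  exact (hf n).norm_toLp_le (hC n)

theorem WeakLim.tendsto_intervalIntegral {f : ℕ → ℝ → ℝ} {g : ℝ → ℝ} (h : WeakLim f g) (a b : ℝ) :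
    Tendsto (fun n => ∫ x in a..b, f n x) atTop (𝓝 (∫ x in a..b, g x)) := by
  have key : ∀ s : Set ℝ, MeasurableSet s → volume s ≠ ⊤ →
      Tendsto (fun n => ∫ x in s, f n x) atTop (𝓝 (∫ x in s, g x)) := by
    intro s hs hs'
    have h1 := h (s.indicator fun _ => (1 : ℝ)) (memLp_indicator_const 2 hs 1 (Or.inr hs'))
    have e : ∀ k : ℝ → ℝ, ∫ x, k x * s.indicator (fun _ => (1 : ℝ)) x = ∫ x in s, k x := fun k => by
      rw [← integral_indicator hs]
      refine integral_congr_ae (ae_of_all _ fun x => ?_)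
      by_cases hx : x ∈ s <;> simp [hx]
    simpa only [e] using h1
  exact (key _ measurableSet_Ioc (by simp)).sub (key _ measurableSet_Ioc (by simp))

/-- Bounded sequences in `H^1(ℝ)` have subsequences converging pointwise, and weakly with their
derivatives. -/
theorem exists_h1_limit {u v : ℕ → ℝ → ℝ} (h : ∀ n, H1Pair (u n) (v n)) {C : ℝ}
    (hC : ∀ n, ∫ x, (u n x ^ 2 + v n x ^ 2) ≤ C) :
    ∃ (φ : ℕ → ℕ) (U V : ℝ → ℝ), StrictMono φ ∧ H1Pair U V ∧
      (∀ x, Tendsto (fun n => u (φ n) x) atTop (𝓝 (U x))) ∧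
      WeakLim (fun n => u (φ n)) U ∧ WeakLim (fun n => v (φ n)) V := by
  have hCu : ∀ n, ∫ x, u n x ^ 2 ≤ C := fun n =>
    (integral_mono (h n).integrable_sq (h n).integrable_sq_add_sq fun x => by
      show u n x ^ 2 ≤ u n x ^ 2 + v n x ^ 2
      linarith [sq_nonneg (v n x)]).trans (hC n)
  have hCv : ∀ n, ∫ x, v n x ^ 2 ≤ C := fun n =>
    (integral_mono (h n).integrable_sq' (h n).integrable_sq_add_sq fun x => by
      show v n x ^ 2 ≤ u n x ^ 2 + v n x ^ 2
      linarith [sq_nonneg (u n x)]).trans (hC n)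
  obtain ⟨φ, V, hφ, hV, hw⟩ := exists_weakLim (fun n => (h n).memLp') hCv
  -- Weak convergence of the derivatives controls increments; convergence of the values at the
  -- single point `0` then gives convergence at every point.
  obtain ⟨l, -, ψ, hψ, hl⟩ := (isCompact_Icc (a := -√C) (b := √C)).tendsto_subseq
    (x := fun n => u (φ n) 0) (fun n => abs_le.1
      (((h (φ n)).abs_le 0).trans (Real.sqrt_le_sqrt (hC _))))
  have hVloc : LocallyIntegrable V volume := hV.locallyIntegrable (by norm_num)
  have hi : ∀ a b, IntervalIntegrable V volume a b := fun a b =>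
    (hVloc.integrableOn_isCompact isCompact_uIcc).intervalIntegrable
  have hprim : IsPrim (fun x => l + ∫ t in (0 : ℝ)..x, V t) V := ⟨hVloc, fun a b => by
    rw [← intervalIntegral.integral_interval_sub_left (hi 0 b) (hi 0 a)]; ring⟩
  have hwψ := hw.comp hψ
  have hpt : ∀ x, Tendsto (fun n => u ((φ ∘ ψ) n) x) atTop (𝓝 (l + ∫ t in (0 : ℝ)..x, V t)) := by
    intro x
    refine (hl.add (hwψ.tendsto_intervalIntegral 0 x)).congr fun n => ?_
    exact ((h _).prim.eq_add 0 x).symm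
  have hU : MemLp (fun x => l + ∫ t in (0 : ℝ)..x, V t) 2 volume :=
    memLp_of_tendsto (fun n => (h ((φ ∘ ψ) n)).memLp) (fun n => hCu _) hpt
  exact ⟨φ ∘ ψ, _, V, hφ.comp hψ, ⟨hU, hV, hprim⟩, hpt,
    weakLim_of_tendsto (fun n => (h ((φ ∘ ψ) n)).memLp) hU (fun n => hCu _) hpt, hwψ⟩

/-! ### Splitting of the constraint and exclusion of loss at infinity -/

theorem exists_abs_add_pow_sub_le {M : ℝ} (hM : 0 ≤ M) (n : ℕ) :
    ∃ C : ℝ, 0 ≤ C ∧ ∀ a b : ℝ, |a| ≤ M → |b| ≤ M →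
      |(a + b) ^ (n + 2) - a ^ (n + 2) - b ^ (n + 2)| ≤ C * (|a| * |b|) := by
  induction n with
  | zero =>
    refine ⟨2, by norm_num, fun a b _ _ => le_of_eq ?_⟩
    have : (a + b) ^ (0 + 2) - a ^ (0 + 2) - b ^ (0 + 2) = 2 * (a * b) := by ring
    rw [this, abs_mul, abs_mul, abs_two]
  | succ n ih =>
    obtain ⟨C, hC, h⟩ := ih
    refine ⟨2 * M * C + 2 * M ^ (n + 1), by positivity, fun a b ha hb => ?_⟩
    -- Only mixed terms survive in the difference, and each contains the factor `a * b`.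
    have e : (a + b) ^ (n + 1 + 2) - a ^ (n + 1 + 2) - b ^ (n + 1 + 2)
        = (a + b) * ((a + b) ^ (n + 2) - a ^ (n + 2) - b ^ (n + 2))
          + a * b * (a ^ (n + 1) + b ^ (n + 1)) := by ring
    rw [e]
    refine (abs_add_le _ _).trans ?_
    rw [abs_mul, abs_mul (a * b), abs_mul a b]
    have h1 : |a + b| ≤ 2 * M := (abs_add_le a b).trans (by linarith)
    have h2 : |a ^ (n + 1) + b ^ (n + 1)| ≤ 2 * M ^ (n + 1) := by
      refine (abs_add_le _ _).trans ?_
      rw [abs_pow, abs_pow]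
      have := pow_le_pow_left₀ (abs_nonneg a) ha (n + 1)
      have := pow_le_pow_left₀ (abs_nonneg b) hb (n + 1)
      linarith
    calc |a + b| * |(a + b) ^ (n + 2) - a ^ (n + 2) - b ^ (n + 2)|
          + |a| * |b| * |a ^ (n + 1) + b ^ (n + 1)|
        ≤ 2 * M * (C * (|a| * |b|)) + |a| * |b| * (2 * M ^ (n + 1)) := by
          gcongr
          exact h a b ha hb
      _ = _ := by ring

theorem H1Pair.integral_sq_le {u v : ℝ → ℝ} (h : H1Pair u v) :
    ∫ x, u x ^ 2 ≤ ∫ x, (u x ^ 2 + v x ^ 2) :=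
  integral_mono h.integrable_sq h.integrable_sq_add_sq fun x => by
    show u x ^ 2 ≤ u x ^ 2 + v x ^ 2
    linarith [sq_nonneg (v x)]

theorem integral_sub_sq_le {f g : ℝ → ℝ} (hf : MemLp f 2 volume) (hg : MemLp g 2 volume) :
    ∫ x, (f x - g x) ^ 2 ≤ 2 * (∫ x, f x ^ 2) + 2 * ∫ x, g x ^ 2 := by
  have hi1 := hf.integrable_sq.const_mul 2
  have hi2 := hg.integrable_sq.const_mul 2
  rw [← integral_const_mul, ← integral_const_mul, ← integral_add hi1 hi2]
  refine integral_mono (hf.sub hg).integrable_sq (hi1.add hi2) fun x => ?_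
  show (f x - g x) ^ 2 ≤ 2 * f x ^ 2 + 2 * g x ^ 2
  nlinarith [sq_nonneg (f x + g x)]

/-- The constraint functional splits along bounded pointwise convergent sequences. -/
theorem constraintK_split (p : ℕ) {u v : ℕ → ℝ → ℝ} {U V : ℝ → ℝ}
    (h : ∀ n, H1Pair (u n) (v n)) (hU : H1Pair U V) {C : ℝ}
    (hC : ∀ n, ∫ x, (u n x ^ 2 + v n x ^ 2) ≤ C)
    (hpt : ∀ x, Tendsto (fun n => u n x) atTop (𝓝 (U x))) :
    Tendsto (fun n => constraintK p (u n) - constraintK p (fun x => u n x - U x)) atTop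
      (𝓝 (constraintK p U)) := by
  have hr : ∀ n, H1Pair (fun x => u n x - U x) (fun x => v n x - V x) := fun n => (h n).sub hU
  set M := √C + √(∫ y, (U y ^ 2 + V y ^ 2)) with hM
  have hUM : ∀ x, |U x| ≤ M := fun x =>
    (hU.abs_le x).trans (by rw [hM]; linarith [Real.sqrt_nonneg C])
  have hrM : ∀ n x, |u n x - U x| ≤ M := fun n x => by
    refine (abs_sub _ _).trans (add_le_add ?_ (hU.abs_le x))
    exact ((h n).abs_le x).trans (Real.sqrt_le_sqrt (hC n))
  obtain ⟨c, hc, hcab⟩ := exists_abs_add_pow_sub_le ((abs_nonneg _).trans (hUM 0)) p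
  -- The mixed terms are bounded by a multiple of `|U| |u n - U|`, whose integral tends to zero
  -- without strong convergence.
  have h0 := tendsto_integral_abs_mul_abs (fun n => (hr n).memLp) hU.memLp
    (C := 2 * C + 2 * ∫ x, U x ^ 2) (fun n => by
      have h1 := integral_sub_sq_le (h n).memLp hU.memLp
      have h2 := (h n).integral_sq_le.trans (hC n)
      linarith)
    (fun x => by simpa using (hpt x).sub_const (U x))
  have hq : 2 ≤ p + 2 := by omega
  have h0' := h0.const_mul (1 / (((p : ℝ) + 1) * ((p : ℝ) + 2)) * c)
  rw [mul_zero] at h0'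
  rw [tendsto_iff_norm_sub_tendsto_zero]
  refine squeeze_zero (fun n => norm_nonneg _) (fun n => ?_) h0'
  have e1 : constraintK p (u n) - constraintK p (fun x => u n x - U x) - constraintK p U
      = 1 / (((p : ℝ) + 1) * ((p : ℝ) + 2)) *
        ∫ x, (u n x ^ (p + 2) - (u n x - U x) ^ (p + 2) - U x ^ (p + 2)) := by
    have hi : Integrable (fun x => u n x ^ (p + 2) - (u n x - U x) ^ (p + 2)) :=
      ((h n).integrable_pow hq).sub ((hr n).integrable_pow hq)
    rw [integral_sub hi (hU.integrable_pow hq),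
      integral_sub ((h n).integrable_pow hq) ((hr n).integrable_pow hq)]
    unfold constraintK
    ring
  rw [e1, norm_mul, Real.norm_of_nonneg (by positivity), mul_assoc]
  refine mul_le_mul_of_nonneg_left ?_ (by positivity)
  rw [← integral_const_mul]
  have hi0 : Integrable (fun x => |U x| * |u n x - U x|) :=
    (H1Pair.integrable_mul hU.memLp (hr n).memLp).norm.congr (ae_of_all _ fun x => by
      simp only [norm_mul, Real.norm_eq_abs])
  refine norm_integral_le_of_norm_le (hi0.const_mul c) (ae_of_all _ fun x => ?_)
  have := hcab (u n x - U x) (U x) (hrM n x) (hUM x)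
  rw [sub_add_cancel, mul_comm |u n x - U x|] at this
  exact this

/-- Here `θ` is the fraction of the constraint kept by the limit. If `θ ≤ 0`, the remainder costs at
least `B > m`. If `0 < θ < 1`, then `θ^a ≥ θ` and `(1 - θ)^a ≥ 1 - θ`, so the total is at least `θ m
+ (1 - θ) B > m`. If `θ > 1`, the limit alone costs more than `m`. -/
theorem theta_eq_one {θ m J B a : ℝ} (ha0 : 0 < a) (ha1 : a < 1) (hm : 0 < m) (hmB : m < B)
    (hJ0 : 0 ≤ J) (hJ : 0 < θ → θ ^ a * m ≤ J) (h : B * |1 - θ| ^ a ≤ m - J) : θ = 1 := by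
  have hB : 0 < B := hm.trans hmB
  rcases le_or_gt θ 0 with h0 | h0
  · have h1 : (1 : ℝ) ≤ |1 - θ| ^ a := by
      refine Real.one_le_rpow ?_ ha0.le
      rw [abs_of_nonneg (by linarith)]; linarith
    nlinarith
  · have hJ' := hJ h0
    rcases lt_trichotomy θ 1 with h1 | h1 | h1
    · have e1 : θ ≤ θ ^ a := by
        simpa using Real.rpow_le_rpow_of_exponent_ge h0 h1.le ha1.le
      have e2 : 1 - θ ≤ |1 - θ| ^ a := by
        rw [abs_of_pos (by linarith)]
        simpa using Real.rpow_le_rpow_of_exponent_ge (by linarith : 0 < 1 - θ)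
          (by linarith) ha1.le
      have e3 := mul_le_mul_of_nonneg_left e2 hB.le
      have e4 := mul_le_mul_of_nonneg_right e1 hm.le
      have e5 : 0 < (B - m) * (1 - θ) := mul_pos (by linarith) (by linarith)
      nlinarith
    · exact h1
    · have e1 : 1 < θ ^ a := Real.one_lt_rpow h1 ha0
      have e2 : 0 ≤ B * |1 - θ| ^ a := by positivity
      nlinarith

/-- The exclusion of vanishing and of dichotomy for even sequences of low energy. -/
theorem constraintK_limit_eq {p : ℕ} (hp : 1 ≤ p) {u v : ℕ → ℝ → ℝ} {U V : ℝ → ℝ}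
    (h : ∀ n, H1Pair (u n) (v n)) (hU : H1Pair U V) {C : ℝ}
    (hC : ∀ n, ∫ x, (u n x ^ 2 + v n x ^ 2) ≤ C)
    (hpt : ∀ x, Tendsto (fun n => u n x) atTop (𝓝 (U x)))
    (he : ∀ n x, u n (-x) = u n x)
    (hK : ∀ n, constraintK p (u n) = constraintK p (soliton 1 p)) {R : ℕ → ℝ} {m J : ℝ}
    (hR : ∀ n, ∫ x, (1 / 2 * (v n x - V x) ^ 2 + 1 / 2 * (u n x - U x) ^ 2) ≤ R n)
    (hRlim : Tendsto R atTop (𝓝 (m - J))) (hm : 0 < m)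
    (hmB : m < 2 * (((p : ℝ) + 2) / 2 * constraintK p (soliton 1 p) *
      (1 / 2) ^ (2 / ((p : ℝ) + 2)))) (hJ0 : 0 ≤ J)
    (hJ : 0 < constraintK p U →
      (constraintK p U / constraintK p (soliton 1 p)) ^ (2 / ((p : ℝ) + 2)) * m ≤ J) :
    constraintK p U = constraintK p (soliton 1 p) := by
  have hβ := constraintK_soliton_pos hp
  have hsplit := constraintK_split p h hU hC hpt
  set β := constraintK p (soliton 1 p)
  set κ := constraintK p U
  simp_rw [hK] at hsplit
  have hr : ∀ n, H1Pair (fun x => u n x - U x) (fun x => v n x - V x) := fun n => (h n).sub hU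
  have hUe : ∀ x, U (-x) = U x := fun x =>
    tendsto_nhds_unique (hpt (-x)) ((hpt x).congr fun n => (he n x).symm)
  have hKr : Tendsto (fun n => constraintK p (fun x => u n x - U x)) atTop (𝓝 (β - κ)) := by
    simpa using hsplit.const_sub β
  -- Evenness is decisive here: a remainder that vanishes asymptotically at the origin pays for two
  -- bumps. Only its `H^1` energy is needed, so the argument also serves the limit problem.
  have hlow : ∀ n, 2 * (((p : ℝ) + 2) / 2 * β *
      (|constraintK p (fun x => u n x - U x)| / (2 * β)) ^ (2 / ((p : ℝ) + 2))) ≤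
      R n + (u n 0 - U 0) ^ 2 := fun n =>
    (sharp_even hp (hr n) (fun x => by rw [he, hUe])).trans (add_le_add_left (hR n) _)
  have hr0 : Tendsto (fun n => (u n 0 - U 0) ^ 2) atTop (𝓝 0) := by
    simpa using ((hpt 0).sub_const (U 0)).pow 2
  have hlim := le_of_tendsto_of_tendsto
    ((((hKr.abs.div_const (2 * β)).rpow_const (p := 2 / ((p : ℝ) + 2))
      (Or.inr (by positivity))).const_mul (((p : ℝ) + 2) / 2 * β)).const_mul 2)
    (hRlim.add hr0) (Eventually.of_forall hlow)
  rw [add_zero] at hlim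
  have hp' : (1 : ℝ) ≤ p := by exact_mod_cast hp
  have hθ := theta_eq_one (θ := κ / β) (a := 2 / ((p : ℝ) + 2)) (by positivity)
    (by rw [div_lt_one (by positivity)]; linarith) hm hmB hJ0
    (fun h0 => hJ ((div_pos_iff_of_pos_right hβ).1 h0)) (le_of_eq_of_le ?_ hlim)
  · rwa [div_eq_one_iff_eq hβ.ne'] at hθ
  · have e : |β - κ| / (2 * β) = 1 / 2 * |1 - κ / β| := by
      have : 1 - κ / β = (β - κ) / β := by field_simp
      rw [this, abs_div, abs_of_pos hβ]
      field_simp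
    rw [e, Real.mul_rpow (by norm_num) (abs_nonneg _)]
    ring

/-! ### Existence of even minimizers -/

/-- `u` is a `C^1` function in `H^2(ℝ)` with derivatives `v` and `w`. -/
structure H2Triple (u v w : ℝ → ℝ) : Prop where
  fst : H1Pair u v
  snd : H1Pair v w

namespace H2Triple

variable {u v w f g k : ℝ → ℝ}

theorem add (h : H2Triple u v w) (h' : H2Triple f g k) :
    H2Triple (fun x => u x + f x) (fun x => v x + g x) (fun x => w x + k x) :=
  ⟨h.fst.add h'.fst, h.snd.add h'.snd⟩

theorem const_mul (c : ℝ) (h : H2Triple u v w) :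
    H2Triple (fun x => c * u x) (fun x => c * v x) (fun x => c * w x) :=
  ⟨h.fst.const_mul c, h.snd.const_mul c⟩

theorem comp_neg (h : H2Triple u v w) :
    H2Triple (fun x => u (-x)) (fun x => -v (-x)) (fun x => w (-x)) :=
  ⟨h.fst.comp_neg, by simpa using h.snd.comp_neg.neg⟩

end H2Triple

/-- The functional `I_{1,μ}` in terms of a function and its two derivatives. -/
noncomputable def energyTriple (μ : ℝ) (u v w : ℝ → ℝ) : ℝ :=
  ∫ x, (μ / 2 * w x ^ 2 + 1 / 2 * v x ^ 2 + 1 / 2 * u x ^ 2)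

theorem energyTriple_eq {μ : ℝ} {u v w : ℝ → ℝ} (hu : MemLp u 2 volume) (hv : MemLp v 2 volume)
    (hw : MemLp w 2 volume) :
    energyTriple μ u v w
      = μ / 2 * (∫ x, w x ^ 2) + 1 / 2 * (∫ x, v x ^ 2) + 1 / 2 * ∫ x, u x ^ 2 := by
  have h1 := hw.integrable_sq.const_mul (μ / 2)
  have h2 := hv.integrable_sq.const_mul (1 / 2)
  have h12 : Integrable (fun x => μ / 2 * w x ^ 2 + 1 / 2 * v x ^ 2) := h1.add h2
  unfold energyTriple
  rw [integral_add h12 (hu.integrable_sq.const_mul _), integral_add h1 h2, integral_const_mul,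
    integral_const_mul, integral_const_mul]

theorem H1Pair.energy_eq {u v : ℝ → ℝ} (h : H1Pair u v) :
    ∫ x, (1 / 2 * v x ^ 2 + 1 / 2 * u x ^ 2)
      = 1 / 2 * (∫ x, v x ^ 2) + 1 / 2 * ∫ x, u x ^ 2 := by
  rw [integral_add (h.integrable_sq'.const_mul _) (h.integrable_sq.const_mul _),
    integral_const_mul, integral_const_mul]

theorem H2Triple.energy_eq {μ : ℝ} {u v w : ℝ → ℝ} (h : H2Triple u v w) :
    energyTriple μ u v w
      = μ / 2 * (∫ x, w x ^ 2) + 1 / 2 * (∫ x, v x ^ 2) + 1 / 2 * ∫ x, u x ^ 2 :=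
  energyTriple_eq h.fst.memLp h.fst.memLp' h.snd.memLp'

theorem H2Triple.energy_ge {μ : ℝ} (hμ : 0 ≤ μ) {u v w : ℝ → ℝ} (h : H2Triple u v w) :
    ∫ x, (1 / 2 * v x ^ 2 + 1 / 2 * u x ^ 2) ≤ energyTriple μ u v w := by
  rw [h.energy_eq, h.fst.energy_eq]
  have : 0 ≤ μ / 2 * ∫ x, w x ^ 2 :=
    mul_nonneg (by positivity) (integral_nonneg fun x => sq_nonneg _)
  linarith

theorem H2Triple.energyI_eq {μ : ℝ} {χ u v w : ℝ → ℝ} (h : H2Triple u v w)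
    (hχ : χ =ᵐ[volume] u) : energyI 1 μ χ = energyTriple μ u v w := by
  have h1 : weakDeriv χ =ᵐ[volume] v :=
    (h.fst.prim.hasWeakDeriv.congr_left hχ.symm).weakDeriv_ae_eq
  have h2 : weakDeriv (weakDeriv χ) =ᵐ[volume] w :=
    (h.snd.prim.hasWeakDeriv.congr_left h1.symm).weakDeriv_ae_eq
  refine integral_congr_ae ?_
  filter_upwards [hχ, h1, h2] with x a b c
  rw [a, b, c]

theorem constraintK_congr {p : ℕ} {u f : ℝ → ℝ} (h : u =ᵐ[volume] f) :
    constraintK p u = constraintK p f := by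
  unfold constraintK
  congr 1
  exact integral_congr_ae (h.mono fun x hx => by simp only [hx])

theorem constraintK_const_mul (p : ℕ) (c : ℝ) (u : ℝ → ℝ) :
    constraintK p (fun x => c * u x) = c ^ (p + 2) * constraintK p u := by
  unfold constraintK
  simp_rw [mul_pow]
  rw [integral_const_mul]
  ring

theorem H2Triple.energy_const_mul {μ c : ℝ} {u v w : ℝ → ℝ} :
    energyTriple μ (fun x => c * u x) (fun x => c * v x) (fun x => c * w x)
      = c ^ 2 * energyTriple μ u v w := by
  unfold energyTriple
  rw [← integral_const_mul]
  congr 1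
  ext x
  ring

/-- The scaling factor carrying a function with constraint value `k` to the value `β`. -/
theorem exists_scaling (p : ℕ) {k β : ℝ} (hk : 0 < k) (hβ : 0 < β) :
    ∃ s : ℝ, 0 < s ∧ s ^ (p + 2) * k = β ∧ (k / β) ^ (2 / ((p : ℝ) + 2)) * s ^ 2 = 1 := by
  have hx : 0 < β / k := by positivity
  have hq : ((p : ℝ) + 2) ≠ 0 := by positivity
  refine ⟨(β / k) ^ (1 / ((p : ℝ) + 2)), by positivity, ?_, ?_⟩
  · rw [← Real.rpow_natCast, ← Real.rpow_mul hx.le]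
    push_cast
    rw [one_div_mul_cancel hq, Real.rpow_one]
    field_simp
  · rw [← Real.rpow_natCast, ← Real.rpow_mul hx.le, show k / β = (β / k)⁻¹ by rw [inv_div],
      Real.inv_rpow hx.le]
    have : 1 / ((p : ℝ) + 2) * ((2 : ℕ) : ℝ) = 2 / ((p : ℝ) + 2) := by push_cast; ring
    rw [this, inv_mul_cancel₀ (by positivity)]

/-- The triple of an even minimizer. -/
structure IsMinTriple (p : ℕ) (μ : ℝ) (u v w : ℝ → ℝ) : Prop where
  triple : H2Triple u v w
  even : ∀ x, u (-x) = u x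
  constraint : constraintK p u = constraintK p (soliton 1 p)
  le : ∀ f g k : ℝ → ℝ, H2Triple f g k → (∀ x, f (-x) = f x) →
    constraintK p f = constraintK p (soliton 1 p) → energyTriple μ u v w ≤ energyTriple μ f g k

/-- The energy has degree two and the constraint degree `p + 2`, so scaling onto the constraint set
makes a lower bound there homogeneous. It bounds the energy of the weak limit before its constraint
value is known, and it frees the variational argument from the constraint. -/
theorem energy_ge_of_forall {p : ℕ} (hp : 1 ≤ p) {μ m : ℝ}
    (hm : ∀ f g k : ℝ → ℝ, H2Triple f g k → (∀ x, f (-x) = f x) →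
      constraintK p f = constraintK p (soliton 1 p) → m ≤ energyTriple μ f g k)
    {f g k : ℝ → ℝ} (h : H2Triple f g k) (he : ∀ x, f (-x) = f x) (hK : 0 < constraintK p f) :
    (constraintK p f / constraintK p (soliton 1 p)) ^ (2 / ((p : ℝ) + 2)) * m
      ≤ energyTriple μ f g k := by
  obtain ⟨s, hs, h1, h2⟩ := exists_scaling p hK (constraintK_soliton_pos hp)
  have h3 := hm _ _ _ (h.const_mul s) (fun x => by rw [he]) (by rw [constraintK_const_mul, h1])
  rw [H2Triple.energy_const_mul] at h3
  calc _ ≤ (constraintK p f / constraintK p (soliton 1 p)) ^ (2 / ((p : ℝ) + 2))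
        * (s ^ 2 * energyTriple μ f g k) :=
        mul_le_mul_of_nonneg_left h3 (Real.rpow_nonneg
          (div_nonneg hK.le (constraintK_soliton_pos hp).le) _)
    _ = energyTriple μ f g k := by rw [← mul_assoc, h2, one_mul]

theorem h2Triple_soliton {p : ℕ} (hp : 1 ≤ p) :
    H2Triple (soliton 1 p) (soliton' p) (soliton'' p) :=
  ⟨h1Pair_soliton hp, h1Pair_soliton' hp⟩

theorem energy_soliton {p : ℕ} (hp : 1 ≤ p) :
    ∫ x, (1 / 2 * soliton' p x ^ 2 + 1 / 2 * soliton 1 p x ^ 2)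
      = ((p : ℝ) + 2) / 2 * constraintK p (soliton 1 p) := by
  have h := h1Pair_soliton hp
  have h1 := integral_soliton_energy hp
  rw [integral_add h.integrable_sq h.integrable_sq'] at h1
  rw [h.energy_eq]
  linarith

theorem energy_ge_soliton {p : ℕ} (hp : 1 ≤ p) {u v : ℝ → ℝ} (h : H1Pair u v)
    (hK : constraintK p u = constraintK p (soliton 1 p)) :
    ((p : ℝ) + 2) / 2 * constraintK p (soliton 1 p) ≤
      ∫ x, (1 / 2 * v x ^ 2 + 1 / 2 * u x ^ 2) := by
  have hβ := constraintK_soliton_pos hp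
  have := sharp_line hp h
  rwa [hK, abs_of_pos hβ, div_self hβ.ne', Real.one_rpow, mul_one] at this

theorem exists_h2_limit {u v w : ℕ → ℝ → ℝ} (h : ∀ n, H2Triple (u n) (v n) (w n)) {C : ℝ}
    (hC : ∀ n, ∫ x, (u n x ^ 2 + v n x ^ 2) ≤ C)
    (hC' : ∀ n, ∫ x, (v n x ^ 2 + w n x ^ 2) ≤ C) :
    ∃ (φ : ℕ → ℕ) (U V W : ℝ → ℝ), StrictMono φ ∧ H2Triple U V W ∧
      (∀ x, Tendsto (fun n => u (φ n) x) atTop (𝓝 (U x))) ∧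
      WeakLim (fun n => u (φ n)) U ∧ WeakLim (fun n => v (φ n)) V ∧
      WeakLim (fun n => w (φ n)) W := by
  obtain ⟨φ, V, W, hφ, hVW, -, hwV, hwW⟩ := exists_h1_limit (fun n => (h n).snd) hC'
  obtain ⟨ψ, U, V', hψ, hUV, hpt, hwU, hwV'⟩ :=
    exists_h1_limit (fun n => (h (φ n)).fst) (fun n => hC (φ n))
  have hae := hwV'.ae_eq (hwV.comp hψ) hUV.memLp' hVW.memLp
  exact ⟨φ ∘ ψ, U, V, W, hφ.comp hψ, ⟨hUV.congr_right hae, hVW⟩, hpt, hwU, hwV.comp hψ,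
    hwW.comp hψ⟩

/-- Existence of even minimizers below the energy of two separated bumps. -/
theorem exists_isMinTriple {p : ℕ} (hp : 1 ≤ p) {μ : ℝ} (hμ : 0 < μ)
    (hB : energyTriple μ (soliton 1 p) (soliton' p) (soliton'' p) <
      2 * (((p : ℝ) + 2) / 2 * constraintK p (soliton 1 p) * (1 / 2) ^ (2 / ((p : ℝ) + 2)))) :
    ∃ u v w : ℝ → ℝ, IsMinTriple p μ u v w := by
  have hβ := constraintK_soliton_pos hp
  set S : Set ℝ := {e | ∃ u v w : ℝ → ℝ, H2Triple u v w ∧ (∀ x, u (-x) = u x) ∧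
    constraintK p u = constraintK p (soliton 1 p) ∧ energyTriple μ u v w = e} with hS
  have hSne : S.Nonempty := ⟨_, _, _, _, h2Triple_soliton hp, soliton_neg p, rfl, rfl⟩
  have hlow : ∀ e ∈ S, ((p : ℝ) + 2) / 2 * constraintK p (soliton 1 p) ≤ e := by
    rintro e ⟨u, v, w, h, -, hK, rfl⟩
    exact (energy_ge_soliton hp h.fst hK).trans (h.energy_ge hμ.le)
  have hSbdd : BddBelow S := ⟨_, hlow⟩
  set m := sInf S with hm
  have hm0 : 0 < m := lt_of_lt_of_le (by positivity) (le_csInf hSne hlow)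
  have hmin : ∀ f g k : ℝ → ℝ, H2Triple f g k → (∀ x, f (-x) = f x) →
      constraintK p f = constraintK p (soliton 1 p) → m ≤ energyTriple μ f g k :=
    fun f g k h he hK => csInf_le hSbdd ⟨f, g, k, h, he, hK, rfl⟩
  have hmB := (hmin _ _ _ (h2Triple_soliton hp) (soliton_neg p) rfl).trans_lt hB
  have hseq : ∀ n : ℕ, ∃ u v w : ℝ → ℝ, (H2Triple u v w ∧ (∀ x, u (-x) = u x) ∧
      constraintK p u = constraintK p (soliton 1 p)) ∧
      energyTriple μ u v w < m + 1 / ((n : ℝ) + 1) := by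
    intro n
    obtain ⟨e, ⟨u, v, w, h1, h2, h3, rfl⟩, he⟩ := exists_lt_of_csInf_lt hSne
      (lt_add_of_pos_right m (by positivity : 0 < 1 / ((n : ℝ) + 1)))
    exact ⟨u, v, w, ⟨h1, h2, h3⟩, he⟩
  choose u v w hu hE using hseq
  have hE1 : ∀ n, energyTriple μ (u n) (v n) (w n) ≤ m + 1 := fun n => by
    have : 1 / ((n : ℝ) + 1) ≤ 1 := by
      rw [div_le_one (by positivity)]; linarith [(Nat.cast_nonneg n : (0 : ℝ) ≤ n)]
    linarith [hE n]
  have hparts : ∀ n, 0 ≤ ∫ x, u n x ^ 2 ∧ 0 ≤ ∫ x, v n x ^ 2 ∧ 0 ≤ ∫ x, w n x ^ 2 := fun n =>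
    ⟨integral_nonneg fun x => sq_nonneg _, integral_nonneg fun x => sq_nonneg _,
      integral_nonneg fun x => sq_nonneg _⟩
  -- The energy controls second derivatives only through `μ`, whence the term with `2 / μ` in the
  -- bound.
  obtain ⟨φ, U, V, W, hφ, hU, hpt, hwU, hwV, hwW⟩ := exists_h2_limit (fun n => (hu n).1)
    (C := 2 * (m + 1) + 2 / μ * (m + 1)) (fun n => by
      rw [integral_add (hu n).1.fst.integrable_sq (hu n).1.fst.integrable_sq']
      have h1 := hE1 n
      rw [(hu n).1.energy_eq] at h1
      obtain ⟨a, b, c⟩ := hparts n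
      have : 0 ≤ 2 / μ * (m + 1) := by positivity
      have : 0 ≤ μ / 2 * ∫ x, w n x ^ 2 := by positivity
      linarith) (fun n => by
      rw [integral_add (hu n).1.snd.integrable_sq (hu n).1.snd.integrable_sq']
      have h1 := hE1 n
      rw [(hu n).1.energy_eq] at h1
      obtain ⟨a, b, c⟩ := hparts n
      have h2 : μ / 2 * ∫ x, w n x ^ 2 ≤ m + 1 := by linarith
      have h3 : ∫ x, w n x ^ 2 ≤ 2 / μ * (m + 1) := by
        calc ∫ x, w n x ^ 2 = 2 / μ * (μ / 2 * ∫ x, w n x ^ 2) := by field_simp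
          _ ≤ _ := by gcongr
      have : 0 ≤ μ / 2 * ∫ x, w n x ^ 2 := by positivity
      linarith)
  have hUe : ∀ x, U (-x) = U x := fun x =>
    tendsto_nhds_unique (hpt (-x)) ((hpt x).congr fun n => ((hu _).2.1 x).symm)
  have hr : ∀ n, H2Triple (fun x => u (φ n) x - U x) (fun x => v (φ n) x - V x)
      (fun x => w (φ n) x - W x) := fun n =>
    ⟨(hu (φ n)).1.fst.sub hU.fst, (hu (φ n)).1.snd.sub hU.snd⟩
  have hElim : Tendsto (fun n => energyTriple μ (u n) (v n) (w n)) atTop (𝓝 m) := by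
    have h1 : Tendsto (fun n : ℕ => m + 1 / ((n : ℝ) + 1)) atTop (𝓝 m) := by
      simpa using tendsto_one_div_add_atTop_nhds_zero_nat.const_add m
    exact tendsto_of_tendsto_of_tendsto_of_le_of_le tendsto_const_nhds h1
      (fun n => hmin _ _ _ (hu n).1 (hu n).2.1 (hu n).2.2) (fun n => (hE n).le)
  have hR : Tendsto (fun n => energyTriple μ (fun x => u (φ n) x - U x) (fun x => v (φ n) x - V x)
      (fun x => w (φ n) x - W x)) atTop (𝓝 (m - energyTriple μ U V W)) := by
    have h1 := hwU.sq_split (fun n => (hu (φ n)).1.fst.memLp) hU.fst.memLp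
    have h2 := hwV.sq_split (fun n => (hu (φ n)).1.snd.memLp) hU.snd.memLp
    have h3 := hwW.sq_split (fun n => (hu (φ n)).1.snd.memLp') hU.snd.memLp'
    have h4 := (hElim.comp hφ.tendsto_atTop).sub
      (((h3.const_mul (μ / 2)).add (h2.const_mul (1 / 2))).add (h1.const_mul (1 / 2)))
    rw [← hU.energy_eq] at h4
    refine h4.congr fun n => ?_
    simp only [Function.comp_apply]
    rw [(hu (φ n)).1.energy_eq, (hr n).energy_eq]
    ring
  have hJ0 : 0 ≤ energyTriple μ U V W := integral_nonneg fun x => by positivity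
  have hKU := constraintK_limit_eq hp (fun n => (hu (φ n)).1.fst) hU.fst
    (C := 2 * (m + 1)) (fun n => by
      rw [integral_add (hu (φ n)).1.fst.integrable_sq (hu (φ n)).1.fst.integrable_sq']
      have h1 := hE1 (φ n)
      rw [(hu (φ n)).1.energy_eq] at h1
      obtain ⟨a, b, c⟩ := hparts (φ n)
      have : 0 ≤ μ / 2 * ∫ x, w (φ n) x ^ 2 := by positivity
      linarith) hpt (fun n => (hu (φ n)).2.1) (fun n => (hu (φ n)).2.2)
    (fun n => (hr n).energy_ge hμ.le) hR hm0 hmB hJ0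
    (fun h0 => energy_ge_of_forall hp hmin hU hUe h0)
  -- The limit `m - J` of the remainder energies is nonnegative.
  have hle : energyTriple μ U V W ≤ m := by
    have := ge_of_tendsto' hR fun n => integral_nonneg fun x => by
      show 0 ≤ μ / 2 * (w (φ n) x - W x) ^ 2 + 1 / 2 * (v (φ n) x - V x) ^ 2
        + 1 / 2 * (u (φ n) x - U x) ^ 2
      positivity
    linarith
  exact ⟨U, V, W, hU, hUe, hKU, fun f g k h he hK => hle.trans (hmin f g k h he hK)⟩

/-! ### First variation and Euler-Lagrange equations -/

theorem hasDerivAt_constraintK (p : ℕ) {u v f g : ℝ → ℝ} (h : H1Pair u v) (k : H1Pair f g) :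
    HasDerivAt (fun s : ℝ => constraintK p (fun x => u x + s * f x))
      (1 / ((p : ℝ) + 1) * ∫ x, u x ^ (p + 1) * f x) 0 := by
  set c : ℕ → ℝ := fun i => ((p + 2).choose i : ℝ) * ∫ x, f x ^ i * u x ^ (p + 2 - i) with hc
  have e : ∀ s : ℝ, constraintK p (fun x => u x + s * f x)
      = 1 / (((p : ℝ) + 1) * ((p : ℝ) + 2)) * ∑ i ∈ Finset.range (p + 2 + 1), s ^ i * c i := by
    intro s
    unfold constraintK
    congr 1
    -- By the binomial formula the constraint is a polynomial in `s`. All coefficients are finite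
    -- because every mixed product has total degree `p + 2 ≥ 2`, and no differentiation under the
    -- integral is needed.
    have e1 : ∀ x, (u x + s * f x) ^ (p + 2) = ∑ i ∈ Finset.range (p + 2 + 1),
        s ^ i * ((p + 2).choose i : ℝ) * (f x ^ i * u x ^ (p + 2 - i)) := fun x => by
      rw [add_comm, add_pow]
      refine Finset.sum_congr rfl fun i _ => ?_
      ring
    simp_rw [e1]
    rw [integral_finsetSum]
    · refine Finset.sum_congr rfl fun i _ => ?_
      rw [integral_const_mul, hc, mul_assoc]
    · intro i hi
      refine (k.integrable_pow_mul_pow h ?_).const_mul _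
      have := Finset.mem_range.1 hi
      omega
  have e' : (fun s : ℝ => constraintK p (fun x => u x + s * f x)) = fun s =>
      1 / (((p : ℝ) + 1) * ((p : ℝ) + 2)) * ∑ i ∈ Finset.range (p + 2 + 1), s ^ i * c i :=
    funext e
  rw [e']
  have hd : HasDerivAt (fun s : ℝ => ∑ i ∈ Finset.range (p + 2 + 1), s ^ i * c i)
      (∑ i ∈ Finset.range (p + 2 + 1), ((i : ℝ) * 0 ^ (i - 1)) * c i) 0 :=
    HasDerivAt.fun_sum fun i _ => (hasDerivAt_pow i 0).mul_const (c i)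
  refine (hd.const_mul _).congr_deriv ?_
  rw [Finset.sum_eq_single 1]
  · have e2 : ∀ x, f x ^ 1 * u x ^ (p + 2 - 1) = u x ^ (p + 1) * f x := fun x => by
      rw [pow_one, mul_comm]; rfl
    simp only [hc, Nat.choose_one_right, e2]
    push_cast
    field_simp
  · intro i _ hi
    rcases Nat.eq_zero_or_pos i with h0 | h0
    · simp [h0]
    · rw [zero_pow (by omega)]; simp
  · intro h1
    exact absurd (Finset.mem_range.2 (by omega)) h1

/-- The first order condition for a minimum of `E` relative to a power of `K`. -/
theorem deriv_eq_of_rpow_le {E K : ℝ → ℝ} {E' K' m β a : ℝ} (hE : HasDerivAt E E' 0)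
    (hK : HasDerivAt K K' 0) (hβ : 0 < β) (hK0 : K 0 = β) (hE0 : E 0 = m)
    (hle : ∀ s, 0 < K s → (K s / β) ^ a * m ≤ E s) : E' = m * a / β * K' := by
  have hone : K 0 / β = 1 := by rw [hK0, div_self hβ.ne']
  have h1 : HasDerivAt (fun s => (K s / β) ^ a) (K' / β * a * (K 0 / β) ^ (a - 1)) 0 :=
    (hK.div_const β).rpow_const (Or.inl (by rw [hone]; exact one_ne_zero))
  have h2 := hE.sub (h1.mul_const m)
  -- Near `s = 0` the constraint stays positive, so the homogeneous inequality holds there, with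
  -- equality at `0`.
  have hmin : IsLocalMin (fun s => E s - (K s / β) ^ a * m) 0 := by
    have hpos : ∀ᶠ s in 𝓝 (0 : ℝ), 0 < K s :=
      hK.continuousAt.eventually (lt_mem_nhds (by rw [hK0]; exact hβ))
    filter_upwards [hpos] with s hs
    have := hle s hs
    simp only [hone, hE0, Real.one_rpow, one_mul, sub_self]
    linarith
  have h3 := hmin.hasDerivAt_eq_zero h2
  rw [hone, Real.one_rpow] at h3
  have e : m * a / β * K' = K' / β * a * 1 * m := by ring
  rw [e]
  linarith

theorem integral_add_mul_sq {f g : ℝ → ℝ} (hf : MemLp f 2 volume) (hg : MemLp g 2 volume)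
    (s : ℝ) : ∫ x, (f x + s * g x) ^ 2
      = (∫ x, f x ^ 2) + s * (2 * ∫ x, f x * g x) + s ^ 2 * ∫ x, g x ^ 2 := by
  have e : ∀ x, (f x + s * g x) ^ 2
      = f x ^ 2 + s * (2 * (f x * g x)) + s ^ 2 * g x ^ 2 := fun x => by ring
  have hi1 := ((H1Pair.integrable_mul hf hg).const_mul 2).const_mul s
  have hi : Integrable (fun x => f x ^ 2 + s * (2 * (f x * g x))) := hf.integrable_sq.add hi1
  simp_rw [e]
  rw [integral_add hi (hg.integrable_sq.const_mul _), integral_add hf.integrable_sq hi1,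
    integral_const_mul, integral_const_mul, integral_const_mul]

theorem hasDerivAt_integral_sq {f g : ℝ → ℝ} (hf : MemLp f 2 volume) (hg : MemLp g 2 volume) :
    HasDerivAt (fun s : ℝ => ∫ x, (f x + s * g x) ^ 2) (2 * ∫ x, f x * g x) 0 := by
  simp_rw [integral_add_mul_sq hf hg]
  have h1 := ((hasDerivAt_id (0 : ℝ)).mul_const (2 * ∫ x, f x * g x)).const_add (∫ x, f x ^ 2)
  have h2 := (hasDerivAt_pow 2 (0 : ℝ)).mul_const (∫ x, g x ^ 2)
  refine (h1.add h2).congr_deriv ?_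
  simp

theorem H2Triple.hasDerivAt_energy {μ : ℝ} {u v w f g k : ℝ → ℝ} (h : H2Triple u v w)
    (h' : H2Triple f g k) :
    HasDerivAt (fun s : ℝ => energyTriple μ (fun x => u x + s * f x) (fun x => v x + s * g x)
      (fun x => w x + s * k x))
      (μ * (∫ x, w x * k x) + (∫ x, v x * g x) + ∫ x, u x * f x) 0 := by
  have e : ∀ s, energyTriple μ (fun x => u x + s * f x) (fun x => v x + s * g x)
      (fun x => w x + s * k x) = _ := fun s => (h.add (h'.const_mul s)).energy_eq
  simp_rw [e]
  have h1 := hasDerivAt_integral_sq h.fst.memLp h'.fst.memLp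
  have h2 := hasDerivAt_integral_sq h.fst.memLp' h'.fst.memLp'
  have h3 := hasDerivAt_integral_sq h.snd.memLp' h'.snd.memLp'
  refine (((h3.const_mul (μ / 2)).add (h2.const_mul (1 / 2))).add
    (h1.const_mul (1 / 2))).congr_deriv ?_
  ring

theorem H1Pair.odd_of_even {u v : ℝ → ℝ} (h : H1Pair u v) (he : ∀ x, u (-x) = u x) :
    (fun x => -v (-x)) =ᵐ[volume] v := by
  have h1 := h.comp_neg.prim.hasWeakDeriv
  have e : (fun x => u (-x)) = u := funext he
  rw [e] at h1
  exact h1.ae_eq h.prim.hasWeakDeriv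

theorem H1Pair.even_of_odd {u v : ℝ → ℝ} (h : H1Pair u v) (he : ∀ x, -u (-x) = u x) :
    (fun x => v (-x)) =ᵐ[volume] v := by
  have h1 := h.comp_neg.neg.prim.hasWeakDeriv
  have e : (fun x => -u (-x)) = u := funext he
  rw [e] at h1
  simp only [neg_neg] at h1
  exact h1.ae_eq h.prim.hasWeakDeriv

theorem H2Triple.odd_of_even {u v w : ℝ → ℝ} (h : H2Triple u v w) (he : ∀ x, u (-x) = u x)
    (x : ℝ) : -v (-x) = v x :=
  congrFun ((Continuous.ae_eq_iff_eq volume (h.snd.continuous.comp continuous_neg).neg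
    h.snd.continuous).1 (h.fst.odd_of_even he)) x

theorem integral_mul_comp_neg {f g : ℝ → ℝ} (hf : (fun x => f (-x)) =ᵐ[volume] f) :
    ∫ x, f x * g (-x) = ∫ x, f x * g x := by
  rw [← integral_neg_eq_self]
  refine integral_congr_ae ?_
  filter_upwards [hf] with x hx
  rw [neg_neg, hx]

theorem IsMinTriple.energy_pos {p : ℕ} (hp : 1 ≤ p) {μ : ℝ} (hμ : 0 ≤ μ) {u v w : ℝ → ℝ}
    (h : IsMinTriple p μ u v w) : 0 < energyTriple μ u v w := by
  have hβ := constraintK_soliton_pos hp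
  exact lt_of_lt_of_le (by positivity)
    ((energy_ge_soliton hp h.triple.fst h.constraint).trans (h.triple.energy_ge hμ))

/-- The Euler-Lagrange equation of even minimizers, for even test functions. -/
theorem IsMinTriple.euler_lagrange_even {p : ℕ} (hp : 1 ≤ p) {μ : ℝ} {u v w f g k : ℝ → ℝ}
    (h : IsMinTriple p μ u v w) (h' : H2Triple f g k) (he : ∀ x, f (-x) = f x) :
    μ * (∫ x, w x * k x) + (∫ x, v x * g x) + (∫ x, u x * f x)
      = 2 * energyTriple μ u v w / (((p : ℝ) + 2) * constraintK p (soliton 1 p)) / ((p : ℝ) + 1)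
        * ∫ x, u x ^ (p + 1) * f x := by
  have hβ := constraintK_soliton_pos hp
  have := deriv_eq_of_rpow_le (h.triple.hasDerivAt_energy h')
    (hasDerivAt_constraintK p h.triple.fst h'.fst) hβ (by simpa using h.constraint)
    (m := energyTriple μ u v w) (by simp) (a := 2 / ((p : ℝ) + 2)) (fun s hs =>
      energy_ge_of_forall hp h.le (h.triple.add (h'.const_mul s))
        (fun x => by rw [h.even, he]) hs)
  rw [this]
  field_simp

/-- The Euler-Lagrange equation of even minimizers. -/
theorem IsMinTriple.euler_lagrange {p : ℕ} (hp : 1 ≤ p) {μ : ℝ} {u v w f g k : ℝ → ℝ}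
    (h : IsMinTriple p μ u v w) (h' : H2Triple f g k) :
    μ * (∫ x, w x * k x) + (∫ x, v x * g x) + (∫ x, u x * f x)
      = 2 * energyTriple μ u v w / (((p : ℝ) + 2) * constraintK p (soliton 1 p)) / ((p : ℝ) + 1)
        * ∫ x, u x ^ (p + 1) * f x := by
  -- The test function is symmetrized. As `u` and `w` are even and `v` is odd, each pairing with the
  -- symmetrized function is twice the original one.
  have key := h.euler_lagrange_even hp (h'.add h'.comp_neg) (fun x => by rw [neg_neg, add_comm])
  have hodd := h.triple.odd_of_even h.even
  have hw := h.triple.snd.even_of_odd hodd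
  have hp1 := h.triple.fst.memLp_pow_succ p
  have e1 : ∫ x, w x * (k x + k (-x)) = 2 * ∫ x, w x * k x := by
    simp_rw [mul_add]
    rw [integral_add (H1Pair.integrable_mul h.triple.snd.memLp' h'.snd.memLp')
      (H1Pair.integrable_mul h.triple.snd.memLp' h'.snd.memLp'.comp_neg_real),
      integral_mul_comp_neg hw]
    ring
  have e2 : ∫ x, v x * (g x + -g (-x)) = 2 * ∫ x, v x * g x := by
    simp_rw [mul_add]
    have hg : MemLp (fun x => -g (-x)) 2 volume := h'.snd.memLp.comp_neg_real.neg
    rw [integral_add (H1Pair.integrable_mul h.triple.snd.memLp h'.snd.memLp)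
      (H1Pair.integrable_mul h.triple.snd.memLp hg)]
    have : ∫ x, v x * -g (-x) = ∫ x, v x * g x := by
      rw [← integral_neg_eq_self]
      refine integral_congr_ae (ae_of_all _ fun x => ?_)
      show v (-x) * -g (- -x) = v x * g x
      rw [neg_neg, ← hodd x]
      ring
    rw [this]
    ring
  have e3 : ∫ x, u x * (f x + f (-x)) = 2 * ∫ x, u x * f x := by
    simp_rw [mul_add]
    rw [integral_add (H1Pair.integrable_mul h.triple.fst.memLp h'.fst.memLp)
      (H1Pair.integrable_mul h.triple.fst.memLp h'.fst.memLp.comp_neg_real),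
      integral_mul_comp_neg (ae_of_all _ h.even)]
    ring
  have e4 : ∫ x, u x ^ (p + 1) * (f x + f (-x)) = 2 * ∫ x, u x ^ (p + 1) * f x := by
    simp_rw [mul_add]
    rw [integral_add (H1Pair.integrable_mul hp1 h'.fst.memLp)
      (H1Pair.integrable_mul hp1 h'.fst.memLp.comp_neg_real),
      integral_mul_comp_neg (ae_of_all _ fun x => by simp only [h.even])]
    ring
  rw [e1, e2, e3, e4] at key
  linarith

/-- The Euler-Lagrange equation of the minimizers of the limit problem. -/
theorem H1Pair.euler_lagrange {p : ℕ} (hp : 1 ≤ p) {u v f g : ℝ → ℝ} (h : H1Pair u v)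
    (hK : constraintK p u = constraintK p (soliton 1 p))
    (hE : ∫ x, (1 / 2 * v x ^ 2 + 1 / 2 * u x ^ 2) ≤
      ((p : ℝ) + 2) / 2 * constraintK p (soliton 1 p)) (h' : H1Pair f g) :
    (∫ x, v x * g x) + (∫ x, u x * f x) = 1 / ((p : ℝ) + 1) * ∫ x, u x ^ (p + 1) * f x := by
  have hβ := constraintK_soliton_pos hp
  have hd : HasDerivAt (fun s : ℝ => ∫ x, (1 / 2 * (v x + s * g x) ^ 2
      + 1 / 2 * (u x + s * f x) ^ 2)) ((∫ x, v x * g x) + ∫ x, u x * f x) 0 := by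
    have e : ∀ s, ∫ x, (1 / 2 * (v x + s * g x) ^ 2 + 1 / 2 * (u x + s * f x) ^ 2) = _ :=
      fun s => (h.add (h'.const_mul s)).energy_eq
    simp_rw [e]
    refine (((hasDerivAt_integral_sq h.memLp' h'.memLp').const_mul (1 / 2)).add
      ((hasDerivAt_integral_sq h.memLp h'.memLp).const_mul (1 / 2))).congr_deriv ?_
    ring
  have := deriv_eq_of_rpow_le hd (hasDerivAt_constraintK p h h') hβ (by simpa using hK)
    (m := ((p : ℝ) + 2) / 2 * constraintK p (soliton 1 p)) (by
      simpa using le_antisymm hE (energy_ge_soliton hp h hK))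
    (a := 2 / ((p : ℝ) + 2)) (fun s hs => by
      have := sharp_line hp (h.add (h'.const_mul s))
      rw [abs_of_pos hs] at this
      linarith)
  rw [this]
  field_simp

/-! ### Regularity from the distributional equation -/

theorem memLp_of_hasCompactSupport {η : ℝ → ℝ} (h : Continuous η) (hc : HasCompactSupport η) :
    MemLp η 2 volume :=
  h.memLp_of_hasCompactSupport hc

theorem h1Pair_of_contDiff {η : ℝ → ℝ} (h : ContDiff ℝ ∞ η) (hc : HasCompactSupport η) :
    H1Pair η (deriv η) := by
  have hη' : Continuous (deriv η) := h.continuous_deriv (by exact_mod_cast le_top)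
  exact h1Pair_of_hasDerivAt (fun x => ((h.differentiable (by simp)) x).hasDerivAt) hη'
    (memLp_of_hasCompactSupport h.continuous hc) (memLp_of_hasCompactSupport hη' hc.deriv)

theorem contDiff_deriv {η : ℝ → ℝ} (h : ContDiff ℝ ∞ η) : ContDiff ℝ ∞ (deriv η) :=
  (contDiff_infty_iff_deriv.1 h).2

theorem h2Triple_of_contDiff {η : ℝ → ℝ} (h : ContDiff ℝ ∞ η) (hc : HasCompactSupport η) :
    H2Triple η (deriv η) (deriv (deriv η)) :=
  ⟨h1Pair_of_contDiff h hc, h1Pair_of_contDiff (contDiff_deriv h) hc.deriv⟩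

/-- A locally integrable function with vanishing second distributional derivative has a constant
weak derivative. -/
theorem hasWeakDeriv_const_of_integral_deriv_deriv_eq_zero {d : ℝ → ℝ}
    (hd : LocallyIntegrable d volume)
    (h : ∀ η : ℝ → ℝ, ContDiff ℝ ∞ η → HasCompactSupport η →
      ∫ x, d x * deriv (deriv η) x = 0) :
    ∃ c : ℝ, HasWeakDeriv d fun _ => c := by
  let b : ContDiffBump (0 : ℝ) := ⟨1, 2, by norm_num, by norm_num⟩
  let ρ : ℝ → ℝ := b.normed volume
  have hρ : ContDiff ℝ ∞ ρ := b.contDiff_normed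
  have hρc : HasCompactSupport ρ := b.hasCompactSupport_normed
  have hρ1 : ∫ x, ρ x = 1 := b.integral_normed
  have hρd : ∀ x, HasDerivAt ρ (deriv ρ x) x := fun x =>
    ((hρ.differentiable (by simp)) x).hasDerivAt
  have hρ' : Continuous (deriv ρ) := hρ.continuous_deriv (by exact_mod_cast le_top)
  refine ⟨-∫ x, d x * deriv ρ x, hd, locallyIntegrable_const _, fun g hg hc => ?_⟩
  have hgd : ∀ x, HasDerivAt g (deriv g x) x := fun x =>
    ((hg.differentiable (by simp)) x).hasDerivAt
  have hg' : Continuous (deriv g) := hg.continuous_deriv (by exact_mod_cast le_top)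
  have hgi : Integrable g := hg.continuous.integrable_of_hasCompactSupport hc
  have hρi : Integrable ρ := hρ.continuous.integrable_of_hasCompactSupport hρc
  -- The mean-zero correction by a bump, now one derivative higher: the pairing of `d` with `g'`
  -- depends on `g` only through `∫ g`.
  obtain ⟨η, h1, h2, h3⟩ := exists_primitive_hasCompactSupport
    (χ := fun x => g x - (∫ y, g y) * ρ x) (hg.sub (contDiff_const.mul hρ))
    (hc.sub hρc.mul_left) (by
      rw [integral_sub hgi (hρi.const_mul _), integral_const_mul, hρ1]; ring)
  have h4 := h η h1 h2
  have e : ∀ x, deriv (fun x => g x - (∫ y, g y) * ρ x) x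
      = deriv g x - (∫ y, g y) * deriv ρ x := fun x =>
    ((hgd x).sub ((hρd x).const_mul _)).deriv
  rw [h3] at h4
  have e' : ∀ x, d x * deriv (fun x => g x - (∫ y, g y) * ρ x) x
      = d x * deriv g x - (∫ y, g y) * (d x * deriv ρ x) := fun x => by rw [e]; ring
  simp_rw [e'] at h4
  have hi1 : Integrable (fun x => d x * deriv g x) :=
    hd.integrable_smul_right_of_hasCompactSupport hg' hc.deriv
  have hi2 : Integrable (fun x => d x * deriv ρ x) :=
    hd.integrable_smul_right_of_hasCompactSupport hρ' hρc.deriv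
  rw [integral_sub hi1 (hi2.const_mul _), integral_const_mul] at h4
  rw [integral_const_mul]
  linarith

theorem isPrim_integral {v : ℝ → ℝ} (h : LocallyIntegrable v volume) :
    IsPrim (fun x => ∫ t in (0 : ℝ)..x, v t) v :=
  ⟨h, fun _ _ => intervalIntegral.integral_interval_sub_left
    (h.integrableOn_isCompact isCompact_uIcc).intervalIntegrable
    (h.integrableOn_isCompact isCompact_uIcc).intervalIntegrable⟩

/-- A locally integrable function whose second distributional derivative is locally integrable
has a representative with absolutely continuous derivative. -/
theorem exists_isPrim_isPrim {w g : ℝ → ℝ} (hw : LocallyIntegrable w volume)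
    (hg : LocallyIntegrable g volume)
    (h : ∀ η : ℝ → ℝ, ContDiff ℝ ∞ η → HasCompactSupport η →
      ∫ x, w x * deriv (deriv η) x = ∫ x, g x * η x) :
    ∃ f z : ℝ → ℝ, w =ᵐ[volume] f ∧ IsPrim f z ∧ IsPrim z g := by
  have h1 := isPrim_integral hg
  set W₁ := fun x => ∫ t in (0 : ℝ)..x, g t
  have h2 := isPrim_integral h1.continuous.locallyIntegrable
  set W₂ := fun x => ∫ t in (0 : ℝ)..x, W₁ t
  -- Subtracting a double primitive of `g` leaves a function whose second distributional derivative
  -- is zero.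
  have hd : LocallyIntegrable (fun x => w x - W₂ x) volume :=
    hw.sub h2.continuous.locallyIntegrable
  obtain ⟨c, hc⟩ := hasWeakDeriv_const_of_integral_deriv_deriv_eq_zero hd fun η hη hηc => by
    have hη1 := contDiff_deriv hη
    have hη2 := (contDiff_deriv hη1).continuous
    have hi1 : Integrable (fun x => w x * deriv (deriv η) x) :=
      hw.integrable_smul_right_of_hasCompactSupport hη2 hηc.deriv.deriv
    have hi2 : Integrable (fun x => W₂ x * deriv (deriv η) x) :=
      (h2.continuous.mul hη2).integrable_of_hasCompactSupport hηc.deriv.deriv.mul_left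
    simp_rw [sub_mul]
    rw [integral_sub hi1 hi2, h η hη hηc, h2.hasWeakDeriv.2.2 _ hη1 hηc.deriv, h1.hasWeakDeriv.2.2 _ hη hηc]
    ring
  obtain ⟨f, hf, hfc⟩ := hc.exists_isPrim
  refine ⟨fun x => f x + W₂ x, fun x => c + W₁ x, ?_, hfc.add h2, ?_⟩
  · filter_upwards [hf] with x hx
    rw [← hx]; ring
  · refine ⟨hg, fun a b => ?_⟩
    rw [← h1.2]; ring

/-- Integration by parts expresses `∫_0^R z²` through `f(R) z(R)` and the convergent integral of `f
g`. If it diverged, `f z = (f²)' / 2` would tend to infinity, so `f²` would grow, contradicting `f ∈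
L²`. -/
theorem memLp_deriv_Ioi {f z g : ℝ → ℝ} (hf : IsPrim f z) (hz : IsPrim z g)
    (hf2 : MemLp f 2 volume) (hg2 : MemLp g 2 volume) :
    IntegrableOn (fun x => z x ^ 2) (Ioi 0) := by
  have hzsq : Continuous (fun x => z x ^ 2) := hz.continuous.pow 2
  have hmul := hf.mul hz
  have hfg := H1Pair.integrable_mul hf2 hg2
  have hid : ∀ R, ∫ x in (0 : ℝ)..R, z x ^ 2
      = f R * z R - f 0 * z 0 - ∫ x in (0 : ℝ)..R, f x * g x := fun R => by
    rw [hmul.2, intervalIntegral.integral_add, add_sub_cancel_right]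
    · simp_rw [sq]
    · exact (hz.continuous.mul hz.continuous).intervalIntegrable _ _
    · exact hfg.intervalIntegrable
  have hmono : Monotone fun R => ∫ x in (0 : ℝ)..R, z x ^ 2 := fun a b hab => by
    have h1 := intervalIntegral.integral_add_adjacent_intervals
      (hzsq.intervalIntegrable (μ := volume) 0 a) (hzsq.intervalIntegrable a b)
    have h2 : 0 ≤ ∫ x in a..b, z x ^ 2 :=
      intervalIntegral.integral_nonneg hab fun x _ => sq_nonneg _
    show ∫ x in (0 : ℝ)..a, z x ^ 2 ≤ ∫ x in (0 : ℝ)..b, z x ^ 2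
    linarith
  rcases tendsto_atTop_of_monotone hmono with htop | ⟨l, hl⟩
  · exfalso
    have hlim := intervalIntegral_tendsto_integral_Ioi 0 hfg.integrableOn tendsto_id
    have hfz : Tendsto (fun R => f R * z R) atTop atTop := by
      have h1 := (htop.atTop_add hlim).atTop_add (tendsto_const_nhds (x := f 0 * z 0))
      refine h1.congr fun R => ?_
      rw [hid]
      simp only [id]
      ring
    obtain ⟨R₀, hR₀⟩ := eventually_atTop.1 (hfz.eventually_ge_atTop 1)
    have hsq := hf.mul hf
    have hge : ∀ R, R₀ + 1 ≤ R → 1 ≤ f R * f R := fun R hR => by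
      have h1 : ∫ x in R₀..R, (1 : ℝ) ≤ ∫ x in R₀..R, (z x * f x + f x * z x) := by
        refine intervalIntegral.integral_mono_on (by linarith)
          (continuous_const.intervalIntegrable _ _) (hsq.intervalIntegrable _ _) fun x hx => ?_
        have := hR₀ x hx.1
        linarith
      rw [← hsq.2, intervalIntegral.integral_const, smul_eq_mul, mul_one] at h1
      nlinarith [mul_self_nonneg (f R₀)]
    have hfin := hf2.integrable_sq.measure_norm_ge_lt_top one_pos
    refine (lt_top_iff_ne_top.1 hfin) (top_unique ?_)
    rw [← Real.volume_Ici (a := R₀ + 1)]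
    refine measure_mono fun x hx => ?_
    show 1 ≤ ‖f x ^ 2‖
    rw [Real.norm_of_nonneg (sq_nonneg _), sq]
    exact hge x hx
  · refine integrableOn_Ioi_of_intervalIntegral_norm_tendsto l 0 (fun R => ?_) tendsto_id
      (hl.congr fun R => ?_)
    · exact (hzsq.integrableOn_Icc).mono_set Ioc_subset_Icc_self
    · refine intervalIntegral.integral_congr fun x _ => ?_
      exact (Real.norm_of_nonneg (sq_nonneg _)).symm

/-- If `f` and `f''` are square integrable, so is `f'`. -/
theorem memLp_deriv {f z g : ℝ → ℝ} (hf : IsPrim f z) (hz : IsPrim z g)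
    (hf2 : MemLp f 2 volume) (hg2 : MemLp g 2 volume) : MemLp z 2 volume := by
  rw [memLp_two_iff_integrable_sq hz.continuous.aestronglyMeasurable, ← integrableOn_univ,
    ← Iic_union_Ioi (a := (0 : ℝ))]
  refine IntegrableOn.union ?_ (memLp_deriv_Ioi hf hz hf2 hg2)
  have h1 := memLp_deriv_Ioi hf.comp_neg (g := fun x => g (-x))
    (by simpa using hz.comp_neg.const_mul (-1)) hf2.comp_neg_real hg2.comp_neg_real
  have h2 := h1.comp_neg
  simpa [integrableOn_Iic_iff_integrableOn_Iio] using h2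

/-- Regularity of even minimizers. -/
theorem IsMinTriple.regularity {p : ℕ} (hp : 1 ≤ p) {μ : ℝ} (hμ : 0 < μ) {u v w : ℝ → ℝ}
    (h : IsMinTriple p μ u v w) :
    ∃ f z g : ℝ → ℝ, H1Pair v f ∧ H1Pair f z ∧ H1Pair z g ∧ Continuous g ∧
      ∀ x, μ * g x - f x + u x
        = 2 * energyTriple μ u v w / (((p : ℝ) + 2) * constraintK p (soliton 1 p)) / ((p : ℝ) + 1)
          * u x ^ (p + 1) := by
  set γ := 2 * energyTriple μ u v w / (((p : ℝ) + 2) * constraintK p (soliton 1 p))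
    / ((p : ℝ) + 1) with hγ
  have hu := h.triple.fst
  have hv := h.triple.snd
  have hup := hu.memLp_pow_succ p
  have hG : MemLp (fun x => μ⁻¹ * (w x - u x + γ * u x ^ (p + 1))) 2 volume :=
    ((hv.memLp'.sub hu.memLp).add (hup.const_mul γ)).const_mul _
  -- Since `∫ v η' = -∫ w η`, the Euler-Lagrange equation says that the second distributional
  -- derivative of `w` is `μ⁻¹ (w - u + γ u^(p+1))`.
  obtain ⟨f, z, hwf, hfz, hzg⟩ := exists_isPrim_isPrim (hv.memLp'.locallyIntegrable (by norm_num))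
    (hG.locallyIntegrable (by norm_num)) fun η hη hηc => by
      have ht := h2Triple_of_contDiff hη hηc
      have h1 := h.euler_lagrange hp ht
      have h2 := hv.integral_mul_add_mul ht.fst
      have hi1 := H1Pair.integrable_mul hv.memLp' ht.fst.memLp
      have hi2 := H1Pair.integrable_mul hu.memLp ht.fst.memLp
      have hi3 := H1Pair.integrable_mul hup ht.fst.memLp
      have hi12 : Integrable (fun x => w x * η x - u x * η x) := hi1.sub hi2
      have e : ∀ x, μ⁻¹ * (w x - u x + γ * u x ^ (p + 1)) * η x
          = μ⁻¹ * ((w x * η x - u x * η x) + γ * (u x ^ (p + 1) * η x)) := fun x => by ring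
      simp_rw [e]
      rw [integral_const_mul, integral_add hi12 (hi3.const_mul _), integral_sub hi1 hi2,
        integral_const_mul, eq_inv_mul_iff_mul_eq₀ hμ.ne']
      linarith
  have hf2 : MemLp f 2 volume := hv.memLp'.ae_eq hwf
  have hz2 := memLp_deriv hfz hzg hf2 hG
  -- Replacing `w` by its continuous representative makes the fourth derivative continuous and the
  -- equation valid at every point.
  have hG' : (fun x => μ⁻¹ * (w x - u x + γ * u x ^ (p + 1)))
      =ᵐ[volume] fun x => μ⁻¹ * (f x - u x + γ * u x ^ (p + 1)) := by
    filter_upwards [hwf] with x hx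
    rw [hx]
  refine ⟨f, z, _, hv.congr_right hwf, ⟨hf2, hz2, hfz⟩,
    ⟨hz2, hG.ae_eq hG', hzg.congr_right hG'⟩, ?_, fun x => ?_⟩
  · exact ((hfz.continuous.sub hu.continuous).add ((hu.continuous.pow _).const_mul γ)).const_mul _
  · rw [mul_inv_cancel_left₀ hμ.ne']
    ring

/-! ### Identification of the minimizer of the limit problem -/

/-- Uniqueness for the initial value problem of the soliton equation. -/
theorem soliton_ode_unique (p : ℕ) {f f' g g' : ℝ → ℝ} {M : ℝ}
    (hf : ∀ x, HasDerivAt f (f' x) x)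
    (hf' : ∀ x, HasDerivAt f' (f x - f x ^ (p + 1) / ((p : ℝ) + 1)) x)
    (hg : ∀ x, HasDerivAt g (g' x) x)
    (hg' : ∀ x, HasDerivAt g' (g x - g x ^ (p + 1) / ((p : ℝ) + 1)) x)
    (hfM : ∀ x, |f x| ≤ M) (hfM' : ∀ x, |f' x| ≤ M) (hgM : ∀ x, |g x| ≤ M)
    (hgM' : ∀ x, |g' x| ≤ M) (h0 : f 0 = g 0) (h0' : f' 0 = g' 0) : f = g := by
  let N : ℝ × ℝ → ℝ × ℝ := fun z => (z.2, z.1 - z.1 ^ (p + 1) / ((p : ℝ) + 1))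
  have hN : ContDiff ℝ 1 N := by
    refine contDiff_snd.prodMk (contDiff_fst.sub ((contDiff_fst.pow _).div_const _))
  -- The vector field is only locally Lipschitz; the bound `M` keeps both trajectories in one ball.
  obtain ⟨K, hK⟩ := (hN.contDiffOn (s := Metric.closedBall 0 M)).exists_lipschitzOnWith
    (by decide) (convex_closedBall 0 M) (isCompact_closedBall 0 M)
  ext x
  have h1 := ODE_solution_unique_of_mem_Ioo (v := fun _ => N) (s := fun _ => Metric.closedBall 0 M)
    (K := K) (a := -|x| - 1) (b := |x| + 1) (t₀ := 0) (f := fun t => (f t, f' t))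
    (g := fun t => (g t, g' t)) (fun _ _ => hK)
    ⟨by linarith [abs_nonneg x], by linarith [abs_nonneg x]⟩
    (fun t _ => ⟨(hf t).prodMk (hf' t), by
      rw [mem_closedBall_zero_iff, Prod.norm_def]
      exact max_le (hfM t) (hfM' t)⟩)
    (fun t _ => ⟨(hg t).prodMk (hg' t), by
      rw [mem_closedBall_zero_iff, Prod.norm_def]
      exact max_le (hgM t) (hgM' t)⟩)
    (by simp only [h0, h0'])
  have h2 := h1 (x := x) ⟨by linarith [neg_abs_le x], by linarith [le_abs_self x]⟩
  exact congrArg Prod.fst h2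

theorem hasDerivAt_potential (p : ℕ) {f : ℝ → ℝ} {f' x : ℝ} (hf : HasDerivAt f f' x) :
    HasDerivAt (fun x => potential p (f x))
      (2 * f' * (f x - f x ^ (p + 1) / ((p : ℝ) + 1))) x := by
  have h := (hf.pow 2).sub ((hf.pow (p + 2)).const_mul (2 / (((p : ℝ) + 1) * ((p : ℝ) + 2))))
  refine h.congr_deriv ?_
  push_cast
  field_simp

/-- For even `p`, up to its sign, the even minimizer of the limit problem is the soliton. -/
theorem eq_soliton_of_minimizer {p : ℕ} (hp : 1 ≤ p) {u v : ℝ → ℝ} (h : H1Pair u v)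
    (he : ∀ x, u (-x) = u x) (hs : Even p → 0 ≤ u 0)
    (hK : constraintK p u = constraintK p (soliton 1 p))
    (hE : ∫ x, (1 / 2 * v x ^ 2 + 1 / 2 * u x ^ 2) ≤
      ((p : ℝ) + 2) / 2 * constraintK p (soliton 1 p)) : u = soliton 1 p := by
  have hup : MemLp (fun x => u x ^ (p + 1) / ((p : ℝ) + 1)) 2 volume :=
    ((h.memLp_pow_succ p).const_mul (((p : ℝ) + 1)⁻¹)).ae_eq
      (ae_of_all _ fun x => (div_eq_inv_mul _ _).symm)
  have hg2 : MemLp (fun x => u x - u x ^ (p + 1) / ((p : ℝ) + 1)) 2 volume := h.memLp.sub hup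
  have hgc : Continuous (fun x => u x - u x ^ (p + 1) / ((p : ℝ) + 1)) :=
    h.continuous.sub ((h.continuous.pow _).div_const _)
  have hweak : HasWeakDeriv v (fun x => u x - u x ^ (p + 1) / ((p : ℝ) + 1)) := by
    refine ⟨h.prim.1, hgc.locallyIntegrable, fun η hη hηc => ?_⟩
    have ht := h1Pair_of_contDiff hη hηc
    have h1 := h.euler_lagrange hp hK hE ht
    have e : ∀ x, (u x - u x ^ (p + 1) / ((p : ℝ) + 1)) * η x
        = u x * η x - 1 / ((p : ℝ) + 1) * (u x ^ (p + 1) * η x) := fun x => by ring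
    simp_rw [e]
    rw [integral_sub (H1Pair.integrable_mul h.memLp ht.memLp)
      ((H1Pair.integrable_mul (h.memLp_pow_succ p) ht.memLp).const_mul _), integral_const_mul]
    linarith
  obtain ⟨f, hvf, hf⟩ := hweak.exists_isPrim
  have huf := h.congr_right hvf
  have hfg : H1Pair f _ := ⟨h.memLp'.ae_eq hvf, hg2, hf⟩
  have hdu := huf.prim.hasDerivAt hf.continuous
  have hdf := hf.hasDerivAt hgc
  -- Conservation of energy for the equation; the constant is zero because `u` and `f` decay.
  have hconst : ∀ x, f x ^ 2 = potential p (u x) := by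
    have hd : ∀ x, HasDerivAt (fun x => f x ^ 2 - potential p (u x)) 0 x := fun x => by
      refine (((hdf x).pow 2).sub (hasDerivAt_potential p (hdu x))).congr_deriv ?_
      push_cast
      ring
    have hc : ∀ x y, f x ^ 2 - potential p (u x) = f y ^ 2 - potential p (u y) := fun x y =>
      is_const_of_deriv_eq_zero (fun x => (hd x).differentiableAt) (fun x => (hd x).deriv) x y
    have hcont : Continuous (potential p) := by unfold potential; fun_prop
    have hlim : Tendsto (fun x => f x ^ 2 - potential p (u x)) atTop (𝓝 0) := by
      have := (hfg.tendsto_atTop.pow 2).sub ((hcont.tendsto 0).comp h.tendsto_atTop)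
      simpa [potential] using this
    intro x
    have h2 := tendsto_nhds_unique (tendsto_const_nhds (x := f x ^ 2 - potential p (u x)))
      (hlim.congr fun y => hc y x)
    linarith
  have hf0 : f 0 = 0 := by
    have := (H2Triple.mk huf hfg).odd_of_even he 0
    rw [neg_zero] at this
    linarith
  have hpot := hconst 0
  rw [hf0, potential_eq] at hpot
  set M := √(∫ y, (u y ^ 2 + f y ^ 2)) + √(∫ y, (f y ^ 2 +
    (u y - u y ^ (p + 1) / ((p : ℝ) + 1)) ^ 2)) with hM
  have hMu : ∀ x, |u x| ≤ M := fun x => (huf.abs_le x).trans (by rw [hM]; simp)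
  have hMf : ∀ x, |f x| ≤ M := fun x => (hfg.abs_le x).trans (by rw [hM]; simp)
  -- Evenness gives `f 0 = 0`, so `u 0` is a zero of the potential. The value `0` would make `u`
  -- vanish identically, against the positive constraint value.
  by_cases hu0 : u 0 = 0
  · exfalso
    have hz := soliton_ode_unique p (f := u) (f' := f) (g := fun _ => 0) (g' := fun _ => 0)
      (M := M) hdu hdf (fun x => hasDerivAt_const x 0)
      (fun x => by simpa using hasDerivAt_const x (0 : ℝ)) hMu hMf
      (fun x => by simpa using (abs_nonneg _).trans (hMu 0))
      (fun x => by simpa using (abs_nonneg _).trans (hMu 0)) hu0 hf0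
    have hβ := constraintK_soliton_pos hp
    rw [← hK, hz] at hβ
    simp [constraintK] at hβ
  · have hu0' : u 0 = solitonMax p := by
      have h1 : 1 - 2 / (((p : ℝ) + 1) * ((p : ℝ) + 2)) * u 0 ^ p = 0 := by
        rcases mul_eq_zero.1 (hpot.symm.trans (by norm_num)) with h2 | h2
        · exact absurd (pow_eq_zero_iff two_ne_zero |>.1 h2) hu0
        · exact h2
      have h2 : u 0 ^ p = solitonMax p ^ p := by
        rw [solitonMax_pow hp]
        field_simp at h1
        linarith
      -- For odd `p` the equality of `p`-th powers already fixes the sign; for even `p` the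
      -- normalization is needed.
      have h0 : 0 ≤ u 0 := by
        rcases Nat.even_or_odd p with hp2 | hp2
        · exact hs hp2
        · exact (hp2.pow_pos_iff.1 (h2 ▸ pow_pos (solitonMax_pos p) p)).le
      exact (pow_left_inj₀ h0 (solitonMax_pos p).le (by omega)).1 h2
    have hS := h1Pair_soliton hp
    have hS' := h1Pair_soliton' hp
    set L := √(∫ y, (soliton 1 p y ^ 2 + soliton' p y ^ 2)) + √(∫ y, (soliton' p y ^ 2 +
      soliton'' p y ^ 2)) with hL
    refine soliton_ode_unique p (M := max M L) hdu hdf (hasDerivAt_soliton hp)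
      (hasDerivAt_soliton' hp) (fun x => (hMu x).trans (le_max_left _ _))
      (fun x => (hMf x).trans (le_max_left _ _))
      (fun x => ((hS.abs_le x).trans (by rw [hL]; simp)).trans (le_max_right _ _))
      (fun x => ((hS'.abs_le x).trans (by rw [hL]; simp)).trans (le_max_right _ _))
      (hu0'.trans (soliton_zero p).symm) ?_
    rw [hf0]
    simp [soliton']

/-! ### Convergence of minimizers and multipliers as `μ → 0` -/

theorem IsMinTriple.neg {p : ℕ} (hp : Even p) {μ : ℝ} {u v w : ℝ → ℝ} (h : IsMinTriple p μ u v w) :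
    IsMinTriple p μ (fun x => -1 * u x) (fun x => -1 * v x) (fun x => -1 * w x) where
  triple := h.triple.const_mul (-1)
  even x := by rw [h.even]
  constraint := by
    rw [constraintK_const_mul, Even.neg_one_pow (hp.add even_two), one_mul, h.constraint]
  le f g k h1 h2 h3 := by
    rw [H2Triple.energy_const_mul]
    simpa using h.le f g k h1 h2 h3

/-- The soliton is a competitor for every `μ`. With `energy_ge_soliton` this squeezes the minimal
energy as `μ → 0`. -/
theorem IsMinTriple.energy_le {p : ℕ} (hp : 1 ≤ p) {μ : ℝ} {u v w : ℝ → ℝ}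
    (h : IsMinTriple p μ u v w) : energyTriple μ u v w ≤
      ((p : ℝ) + 2) / 2 * constraintK p (soliton 1 p) + μ / 2 * ∫ x, soliton'' p x ^ 2 := by
  refine (h.le _ _ _ (h2Triple_soliton hp) (soliton_neg p) rfl).trans (le_of_eq ?_)
  rw [(h2Triple_soliton hp).energy_eq, ← energy_soliton hp, (h1Pair_soliton hp).energy_eq]
  ring

/-- Strict subadditivity: the exponent `2 / (p + 2)` is less than one, so splitting the constraint
into two equal parts costs strictly more. This gap makes compactness possible at `μ = 0` and, by
continuity, for small `μ`. -/
theorem half_rpow_bound {p : ℕ} (hp : 1 ≤ p) :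
    ((p : ℝ) + 2) / 2 * constraintK p (soliton 1 p) <
      2 * (((p : ℝ) + 2) / 2 * constraintK p (soliton 1 p) * (1 / 2) ^ (2 / ((p : ℝ) + 2))) := by
  have hβ := constraintK_soliton_pos hp
  have hp' : (1 : ℝ) ≤ p := by exact_mod_cast hp
  have h1 : (1 / 2 : ℝ) < (1 / 2) ^ (2 / ((p : ℝ) + 2)) := by
    have : (2 / ((p : ℝ) + 2)) < 1 := by rw [div_lt_one (by positivity)]; linarith
    simpa using Real.rpow_lt_rpow_of_exponent_gt (by norm_num : (0 : ℝ) < 1 / 2) (by norm_num) this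
  have h2 : 0 < ((p : ℝ) + 2) / 2 * constraintK p (soliton 1 p) := by positivity
  nlinarith

/-- Even minimizing sequences of the limit problem converge to the soliton along a subsequence. -/
theorem exists_subseq_tendsto_soliton {p : ℕ} (hp : 1 ≤ p) {u v : ℕ → ℝ → ℝ}
    (h : ∀ n, H1Pair (u n) (v n)) (he : ∀ n x, u n (-x) = u n x)
    (hs : Even p → ∀ n, 0 ≤ u n 0)
    (hK : ∀ n, constraintK p (u n) = constraintK p (soliton 1 p))
    (hE : Tendsto (fun n => ∫ x, (1 / 2 * v n x ^ 2 + 1 / 2 * u n x ^ 2)) atTop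
      (𝓝 (((p : ℝ) + 2) / 2 * constraintK p (soliton 1 p)))) :
    ∃ φ : ℕ → ℕ, Tendsto (fun n => ∫ x, ((u (φ n) x - soliton 1 p x) ^ 2
      + (v (φ n) x - soliton' p x) ^ 2)) atTop (𝓝 0) := by
  have hβ := constraintK_soliton_pos hp
  obtain ⟨C, hC⟩ := hE.bddAbove_range
  have hCn : ∀ n, ∫ x, (u n x ^ 2 + v n x ^ 2) ≤ 2 * C := fun n => by
    have h1 := hC (mem_range_self n)
    simp only [(h n).energy_eq] at h1
    rw [integral_add (h n).integrable_sq (h n).integrable_sq']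
    linarith
  obtain ⟨φ, U, V, hφ, hU, hpt, hwU, hwV⟩ := exists_h1_limit h hCn
  have hUe : ∀ x, U (-x) = U x := fun x =>
    tendsto_nhds_unique (hpt (-x)) ((hpt x).congr fun n => (he _ x).symm)
  have hR : Tendsto (fun n => ∫ x, (1 / 2 * (v (φ n) x - V x) ^ 2
      + 1 / 2 * (u (φ n) x - U x) ^ 2)) atTop (𝓝 (((p : ℝ) + 2) / 2 * constraintK p (soliton 1 p)
        - ∫ x, (1 / 2 * V x ^ 2 + 1 / 2 * U x ^ 2))) := by
    have h1 := hwU.sq_split (fun n => (h (φ n)).memLp) hU.memLp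
    have h2 := hwV.sq_split (fun n => (h (φ n)).memLp') hU.memLp'
    have h4 := (hE.comp hφ.tendsto_atTop).sub ((h2.const_mul (1 / 2)).add (h1.const_mul (1 / 2)))
    rw [← hU.energy_eq] at h4
    refine h4.congr fun n => ?_
    simp only [Function.comp_apply]
    rw [(h (φ n)).energy_eq, ((h (φ n)).sub hU).energy_eq]
    ring
  have hKU := constraintK_limit_eq hp (fun n => h (φ n)) hU (fun n => hCn _) hpt
    (fun n => he _) (fun n => hK _) (fun n => le_rfl) hR (by positivity) (half_rpow_bound hp)
    (integral_nonneg fun x => by positivity) (fun h0 => by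
      have := sharp_line hp hU
      rw [abs_of_pos h0] at this
      linarith)
  have hle : ∫ x, (1 / 2 * V x ^ 2 + 1 / 2 * U x ^ 2)
      ≤ ((p : ℝ) + 2) / 2 * constraintK p (soliton 1 p) := by
    have := ge_of_tendsto' hR fun n => integral_nonneg fun x => by
      show 0 ≤ 1 / 2 * (v (φ n) x - V x) ^ 2 + 1 / 2 * (u (φ n) x - U x) ^ 2
      positivity
    linarith
  have hUS := eq_soliton_of_minimizer hp hU hUe
    (fun hp2 => ge_of_tendsto' (hpt 0) fun n => hs hp2 _) hKU hle
  have hVS : V =ᵐ[volume] soliton' p :=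
    hU.weakDeriv_ae_eq.symm.trans (hUS ▸ (h1Pair_soliton hp).weakDeriv_ae_eq)
  -- The limit keeps the whole energy, so the remainder energy tends to zero and weak convergence
  -- becomes strong.
  rw [le_antisymm hle (energy_ge_soliton hp hU hKU), sub_self] at hR
  refine ⟨φ, ?_⟩
  have h2 := hR.const_mul 2
  rw [mul_zero] at h2
  refine h2.congr fun n => ?_
  rw [← integral_const_mul]
  refine integral_congr_ae ?_
  filter_upwards [hVS] with x hx
  rw [hx, hUS]
  ring

/-- Even minimizers converge to the soliton as the parameter tends to zero. -/
theorem tendsto_minimizer_soliton {p : ℕ} (hp : 1 ≤ p) {μ₀ : ℝ} (hμ₀ : 0 < μ₀)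
    {u v w : ℝ → ℝ → ℝ} (h : ∀ μ ∈ Ioo (0 : ℝ) μ₀, IsMinTriple p μ (u μ) (v μ) (w μ))
    (hs : Even p → ∀ μ ∈ Ioo (0 : ℝ) μ₀, 0 ≤ u μ 0) :
    Tendsto (fun μ => ∫ x, ((u μ x - soliton 1 p x) ^ 2 + (v μ x - soliton' p x) ^ 2))
      (𝓝[>] 0) (𝓝 0) := by
  -- The limit is the same for all subsequences, so the whole family converges.
  refine tendsto_of_subseq_tendsto fun ns hns => ?_
  have hev := hns.eventually (Ioo_mem_nhdsGT hμ₀)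
  obtain ⟨N, hN⟩ := eventually_atTop.1 hev
  have hmem : ∀ n, ns (n + N) ∈ Ioo (0 : ℝ) μ₀ := fun n => hN _ (Nat.le_add_left N n)
  have hlim0 : Tendsto (fun n => ns (n + N)) atTop (𝓝 0) :=
    (hns.mono_right nhdsWithin_le_nhds).comp (tendsto_add_atTop_nat N)
  have hE : Tendsto (fun n => ∫ x, (1 / 2 * v (ns (n + N)) x ^ 2 + 1 / 2 * u (ns (n + N)) x ^ 2))
      atTop (𝓝 (((p : ℝ) + 2) / 2 * constraintK p (soliton 1 p))) := by
    have hup := ((hlim0.div_const 2).mul_const (∫ x, soliton'' p x ^ 2)).const_add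
      (((p : ℝ) + 2) / 2 * constraintK p (soliton 1 p))
    rw [zero_div, zero_mul, add_zero] at hup
    exact tendsto_of_tendsto_of_tendsto_of_le_of_le tendsto_const_nhds hup
      (fun n => energy_ge_soliton hp (h _ (hmem n)).triple.fst (h _ (hmem n)).constraint)
      (fun n => ((h _ (hmem n)).triple.energy_ge (hmem n).1.le).trans
        ((h _ (hmem n)).energy_le hp))
  obtain ⟨φ, hφ⟩ := exists_subseq_tendsto_soliton hp (fun n => (h _ (hmem n)).triple.fst)
    (fun n => (h _ (hmem n)).even) (fun hp2 n => hs hp2 _ (hmem n))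
    (fun n => (h _ (hmem n)).constraint) hE
  exact ⟨fun n => φ n + N, hφ⟩

theorem normH1_eq {f u v : ℝ → ℝ} (h : H1Pair u v) (hf : f = u) :
    normH1 f = √(∫ x, (u x ^ 2 + v x ^ 2)) := by
  subst hf
  unfold normH1
  congr 1
  refine integral_congr_ae ?_
  filter_upwards [h.weakDeriv_ae_eq] with x hx
  rw [hx]

/-- From `a u - f = a (u - f) + (a - 1) f`. It transfers convergence from the minimizers to their
rescalings as `a → 1`. -/
theorem integral_smul_sub_sq_le {u v f g : ℝ → ℝ} (h : H1Pair u v) (k : H1Pair f g) (a : ℝ) :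
    ∫ x, ((a * u x - f x) ^ 2 + (a * v x - g x) ^ 2)
      ≤ 2 * a ^ 2 * (∫ x, ((u x - f x) ^ 2 + (v x - g x) ^ 2))
        + 2 * (a - 1) ^ 2 * ∫ x, (f x ^ 2 + g x ^ 2) := by
  have hi1 := (h.sub k).integrable_sq_add_sq.const_mul (2 * a ^ 2)
  have hi2 := k.integrable_sq_add_sq.const_mul (2 * (a - 1) ^ 2)
  rw [← integral_const_mul, ← integral_const_mul, ← integral_add hi1 hi2]
  refine integral_mono ((h.const_mul a).sub k).integrable_sq_add_sq (hi1.add hi2) fun x => ?_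
  show (a * u x - f x) ^ 2 + (a * v x - g x) ^ 2 ≤ 2 * a ^ 2 * ((u x - f x) ^ 2 + (v x - g x) ^ 2)
    + 2 * (a - 1) ^ 2 * (f x ^ 2 + g x ^ 2)
  nlinarith [sq_nonneg (a * (u x - f x) - (a - 1) * f x),
    sq_nonneg (a * (v x - g x) - (a - 1) * g x)]

/-- The Lagrange multiplier of a minimizer. -/
noncomputable def multiplier (p : ℕ) (μ : ℝ) (u v w : ℝ → ℝ) : ℝ :=
  2 * energyTriple μ u v w / (((p : ℝ) + 2) * constraintK p (soliton 1 p))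

theorem tendsto_multiplier {p : ℕ} (hp : 1 ≤ p) {μ₀ : ℝ} (hμ₀ : 0 < μ₀)
    {u v w : ℝ → ℝ → ℝ} (h : ∀ μ ∈ Ioo (0 : ℝ) μ₀, IsMinTriple p μ (u μ) (v μ) (w μ)) :
    Tendsto (fun μ => multiplier p μ (u μ) (v μ) (w μ)) (𝓝[>] 0) (𝓝 1) := by
  have hβ := constraintK_soliton_pos hp
  have hE : Tendsto (fun μ => energyTriple μ (u μ) (v μ) (w μ)) (𝓝[>] 0)
      (𝓝 (((p : ℝ) + 2) / 2 * constraintK p (soliton 1 p))) := by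
    have hlim0 : Tendsto (fun μ : ℝ => μ) (𝓝[>] 0) (𝓝 0) := nhdsWithin_le_nhds
    have hup := ((hlim0.div_const 2).mul_const (∫ x, soliton'' p x ^ 2)).const_add
      (((p : ℝ) + 2) / 2 * constraintK p (soliton 1 p))
    rw [zero_div, zero_mul, add_zero] at hup
    refine tendsto_of_tendsto_of_tendsto_of_le_of_le' tendsto_const_nhds hup ?_ ?_
    · filter_upwards [Ioo_mem_nhdsGT hμ₀] with μ hμ
      exact (energy_ge_soliton hp (h _ hμ).triple.fst (h _ hμ).constraint).trans
        ((h _ hμ).triple.energy_ge hμ.1.le)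
    · filter_upwards [Ioo_mem_nhdsGT hμ₀] with μ hμ
      exact (h _ hμ).energy_le hp
  have h1 := (hE.const_mul 2).div_const (((p : ℝ) + 2) * constraintK p (soliton 1 p))
  have e : 2 * (((p : ℝ) + 2) / 2 * constraintK p (soliton 1 p))
      / (((p : ℝ) + 2) * constraintK p (soliton 1 p)) = 1 := by field_simp
  rwa [e] at h1

/-! ### Return to weak derivatives, and conclusion -/

theorem IsMinTriple.isEvenMinimizer {p : ℕ} {μ : ℝ} {u v w : ℝ → ℝ} (h : IsMinTriple p μ u v w) :
    IsEvenMinimizer 1 p μ (constraintK p (soliton 1 p)) u := by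
  refine ⟨⟨h.triple.fst.memH_two h.triple.snd, ae_of_all _ h.even⟩, h.constraint,
    fun χ hχ hK => ?_⟩
  -- A competitor is even only almost everywhere; its continuous representative is even at every
  -- point.
  obtain ⟨f, g, k, hfg, hgk, hf, -, -⟩ := hχ.1.exists_h1Pair
  have ht : H2Triple f g k := ⟨hfg, hgk⟩
  rw [h.triple.energyI_eq (ae_eq_refl u), ht.energyI_eq hf]
  exact h.le f g k ht (even_of_ae_even hχ.2 hf hfg.continuous) ((constraintK_congr hf).symm.trans hK)

theorem IsMinTriple.isLagrangeMultiplier {p : ℕ} (hp : 1 ≤ p) {μ : ℝ} {u v w : ℝ → ℝ}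
    (h : IsMinTriple p μ u v w) :
    IsLagrangeMultiplier 1 p μ u (multiplier p μ u v w) := by
  intro χ hχ
  obtain ⟨f, g, k, hfg, hgk, hf, hg, hk⟩ := hχ.exists_h1Pair
  have key := h.euler_lagrange hp ⟨hfg, hgk⟩
  have h1 := h.triple.fst.weakDeriv_ae_eq
  have h2 := h.triple.fst.weakDeriv_weakDeriv_ae_eq h.triple.snd
  have e1 : ∫ x, weakDeriv (weakDeriv u) x * weakDeriv (weakDeriv χ) x = ∫ x, w x * k x :=
    integral_congr_ae (h2.mul hk)
  have e2 : ∫ x, weakDeriv u x * weakDeriv χ x = ∫ x, v x * g x :=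
    integral_congr_ae (h1.mul hg)
  have e3 : ∫ x, u x * χ x = ∫ x, u x * f x :=
    integral_congr_ae ((ae_eq_refl u).mul hf)
  have e4 : ∫ x, u x ^ (p + 1) * χ x = ∫ x, u x ^ (p + 1) * f x :=
    integral_congr_ae (by filter_upwards [hf] with x hx; rw [hx])
  rw [e1, e2, e3, e4, one_mul, multiplier]
  exact key

theorem isSolitaryWave_of_hasDerivAt {p : ℕ} {μ : ℝ} {f f1 f2 f3 f4 : ℝ → ℝ}
    (h1 : ∀ x, HasDerivAt f (f1 x) x) (h2 : ∀ x, HasDerivAt f1 (f2 x) x)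
    (h3 : ∀ x, HasDerivAt f2 (f3 x) x) (h4 : ∀ x, HasDerivAt f3 (f4 x) x) (hc : Continuous f4)
    (heq : ∀ x, μ * f4 x - f2 x + f x = 1 / ((p : ℝ) + 1) * f x ^ (p + 1)) :
    IsSolitaryWave 1 p μ f := by
  have d1 : deriv f = f1 := funext fun x => (h1 x).deriv
  have d2 : deriv f1 = f2 := funext fun x => (h2 x).deriv
  have d3 : deriv f2 = f3 := funext fun x => (h3 x).deriv
  have d4 : deriv f3 = f4 := funext fun x => (h4 x).deriv
  have c3 : ContDiff ℝ 1 f3 :=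
    contDiff_one_iff_deriv.2 ⟨fun x => (h4 x).differentiableAt, by rwa [d4]⟩
  have step : ∀ (n : ℕ) (a b : ℝ → ℝ), (∀ x, HasDerivAt a (b x) x) → ContDiff ℝ n b →
      ContDiff ℝ (n + 1 : ℕ) a := fun n a b hab hb => by
    have hd : deriv a = b := funext fun x => (hab x).deriv
    push_cast
    rw [contDiff_succ_iff_deriv]
    exact ⟨fun x => (hab x).differentiableAt, by simp, by rwa [hd]⟩
  have c0 := step 3 f f1 h1 (step 2 f1 f2 h2 (step 1 f2 f3 h3 (by exact_mod_cast c3)))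
  have i2 : iteratedDeriv 2 f = f2 := by
    rw [iteratedDeriv_succ, iteratedDeriv_one, d1, d2]
  have i4 : iteratedDeriv 4 f = f4 := by
    rw [iteratedDeriv_succ, iteratedDeriv_succ, i2, d3, d4]
  refine ⟨by exact_mod_cast c0, fun x => ?_⟩
  rw [i2, i4, one_mul]
  exact heq x

theorem exists_isMinTriple_sign {p : ℕ} (hp : 1 ≤ p) {μ : ℝ} (hμ : 0 < μ)
    (hB : energyTriple μ (soliton 1 p) (soliton' p) (soliton'' p) <
      2 * (((p : ℝ) + 2) / 2 * constraintK p (soliton 1 p) * (1 / 2) ^ (2 / ((p : ℝ) + 2)))) :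
    ∃ u v w : ℝ → ℝ, IsMinTriple p μ u v w ∧ (Even p → 0 ≤ u 0) := by
  obtain ⟨u, v, w, h⟩ := exists_isMinTriple hp hμ hB
  by_cases hs : Even p → 0 ≤ u 0
  · exact ⟨u, v, w, h, hs⟩
  · push Not at hs
    exact ⟨_, _, _, h.neg hs.1, fun _ => by linarith [hs.2]⟩

end GKW

theorem lemma3p1 (p : ℕ) (hp : 1 ≤ p) :
    ∃ μ₀ : ℝ, 0 < μ₀ ∧ ∃ (α : ℝ → ℝ) (ψ φ : ℝ → ℝ → ℝ),
      (∀ μ ∈ Ioo (0 : ℝ) μ₀,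
        IsEvenMinimizer 1 p μ (constraintK p (soliton 1 p)) (ψ μ) ∧
        0 < α μ ∧ IsLagrangeMultiplier 1 p μ (ψ μ) (α μ) ∧
        (∀ x : ℝ, φ μ x = (α μ) ^ (1 / (p : ℝ)) * ψ μ x) ∧
        MemH 4 (φ μ) ∧ (∀ x : ℝ, φ μ (-x) = φ μ x) ∧
        IsSolitaryWave 1 p μ (φ μ)) ∧
      Tendsto (fun μ : ℝ => normH1 (fun x => φ μ x - soliton 1 p x)) (𝓝[>] 0) (𝓝 0) := by
  have hβ := constraintK_soliton_pos hp
  have hS := h2Triple_soliton hp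
  -- The energy of the soliton is affine in `μ`, and its value at `μ = 0` lies strictly below the
  -- two-bump threshold.
  obtain ⟨μ₀, hμ₀, hlt⟩ : ∃ μ₀ : ℝ, 0 < μ₀ ∧ ∀ μ ∈ Ioo (0 : ℝ) μ₀,
      energyTriple μ (soliton 1 p) (soliton' p) (soliton'' p) <
      2 * (((p : ℝ) + 2) / 2 * constraintK p (soliton 1 p) * (1 / 2) ^ (2 / ((p : ℝ) + 2))) := by
    have hlim : Tendsto (fun μ => energyTriple μ (soliton 1 p) (soliton' p) (soliton'' p)) (𝓝[>] 0)
        (𝓝 (((p : ℝ) + 2) / 2 * constraintK p (soliton 1 p))) := by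
      have hlim0 : Tendsto (fun μ : ℝ => μ) (𝓝[>] 0) (𝓝 0) := nhdsWithin_le_nhds
      have hup := ((hlim0.div_const 2).mul_const (∫ x, soliton'' p x ^ 2)).const_add
        (((p : ℝ) + 2) / 2 * constraintK p (soliton 1 p))
      rw [zero_div, zero_mul, add_zero] at hup
      refine hup.congr fun μ => ?_
      rw [hS.energy_eq, ← energy_soliton hp, hS.fst.energy_eq]
      ring
    obtain ⟨μ₀, h1, h2⟩ := (mem_nhdsGT_iff_exists_Ioo_subset).1
      (hlim.eventually (gt_mem_nhds (half_rpow_bound hp)))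
    exact ⟨μ₀, h1, fun μ hμ => h2 hμ⟩
  have hex : ∀ μ : ℝ, ∃ u v w : ℝ → ℝ, μ ∈ Ioo (0 : ℝ) μ₀ →
      IsMinTriple p μ u v w ∧ (Even p → 0 ≤ u 0) := fun μ => by
    by_cases hμ : μ ∈ Ioo (0 : ℝ) μ₀
    · obtain ⟨u, v, w, h⟩ := exists_isMinTriple_sign hp hμ.1 (hlt μ hμ)
      exact ⟨u, v, w, fun _ => h⟩
    -- Outside the interval the functions are irrelevant; zero is a default value.
    · exact ⟨0, 0, 0, fun h => absurd h hμ⟩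
  choose u v w huvw using hex
  have hmin : ∀ μ ∈ Ioo (0 : ℝ) μ₀, IsMinTriple p μ (u μ) (v μ) (w μ) := fun μ hμ =>
    (huvw μ hμ).1
  set α : ℝ → ℝ := fun μ => multiplier p μ (u μ) (v μ) (w μ) with hα
  refine ⟨μ₀, hμ₀, α, u, fun μ x => α μ ^ (1 / (p : ℝ)) * u μ x, fun μ hμ => ?_, ?_⟩
  · have h := hmin μ hμ
    have hα0 : 0 < α μ := by
      have := h.energy_pos hp hμ.1.le
      simp only [hα, multiplier]
      positivity
    obtain ⟨f, z, g, hf, hz, hg, hgc, heq⟩ := h.regularity hp hμ.1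
    set a := α μ ^ (1 / (p : ℝ)) with ha
    have hap : a ^ p = α μ := by
      rw [ha, one_div, Real.rpow_inv_natCast_pow hα0.le (by omega)]
    have k1 := h.triple.fst.const_mul a
    have k2 := hf.const_mul a
    have k3 := hz.const_mul a
    have k4 := hg.const_mul a
    refine ⟨h.isEvenMinimizer, hα0, h.isLagrangeMultiplier hp, fun x => rfl, ?_,
      fun x => by simp only [h.even], ?_⟩
    · exact ⟨k1.memLp, _, k1.prim.hasWeakDeriv, k2.memLp, _, k2.prim.hasWeakDeriv, k3.memLp, _,
        k3.prim.hasWeakDeriv, k4.memLp, _, k4.prim.hasWeakDeriv, k4.memLp'⟩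
    · refine isSolitaryWave_of_hasDerivAt (k1.prim.hasDerivAt k2.continuous)
        (k2.prim.hasDerivAt k3.continuous) (k3.prim.hasDerivAt k4.continuous)
        (k4.prim.hasDerivAt (continuous_const.mul hgc)) (continuous_const.mul hgc) fun x => ?_
      have e := heq x
      change μ * g x - f x + u μ x = α μ / ((p : ℝ) + 1) * u μ x ^ (p + 1) at e
      rw [mul_pow, pow_succ, hap]
      -- Multiplying the equation of `u` by `a` and using `a ^ p = α` absorbs the multiplier into
      -- the nonlinearity.
      linear_combination a * e
  · have ha : Tendsto (fun μ => α μ ^ (1 / (p : ℝ))) (𝓝[>] 0) (𝓝 1) := by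
      have := (tendsto_multiplier hp hμ₀ hmin).rpow_const (p := 1 / (p : ℝ))
        (Or.inl one_ne_zero)
      rwa [Real.one_rpow] at this
    have hd := tendsto_minimizer_soliton hp hμ₀ hmin fun hp2 μ hμ => (huvw μ hμ).2 hp2
    have hbound := ((((ha.pow 2).const_mul 2).mul hd).add
      ((((ha.sub_const 1).pow 2).const_mul 2).mul_const
        (∫ x, (soliton 1 p x ^ 2 + soliton' p x ^ 2)))).sqrt
    have e0 : √(2 * 1 ^ 2 * 0 + 2 * (1 - 1) ^ 2 * ∫ x, (soliton 1 p x ^ 2 + soliton' p x ^ 2))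
        = 0 := by simp
    rw [e0] at hbound
    refine tendsto_of_tendsto_of_tendsto_of_le_of_le' tendsto_const_nhds hbound
      (Eventually.of_forall fun μ => Real.sqrt_nonneg _) ?_
    filter_upwards [Ioo_mem_nhdsGT hμ₀] with μ hμ
    have h := (hmin μ hμ).triple.fst
    rw [normH1_eq ((h.const_mul (α μ ^ (1 / (p : ℝ)))).sub hS.fst) rfl]
    exact Real.sqrt_le_sqrt (integral_smul_sub_sq_le h hS.fst _)
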